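/- **Model.** Fix $\rho,\tau_g,\tau_r\in(0,1)$. For $n,w\in\mathbb N$, $n\ge 1$, consider the ring $\mathbb Z/n\mathbb Z$ of $n$ nodes. Initially each node is, independently, green with probability $\rho$ and red with probability $1-\rho$. The neighbourhood of a node $x$ is $\mathcal N(x)=[x-w,x+w]$. A green (red) node is *happy* if $\mathcal N(x)$ contains at least $\tau_g(2w+1)$ green (at least $\tau_r(2w+1)$ red) nodes, and *unhappy* otherwise. An unhappy node is *hopeful* if changing its colour would make it happy. In the *selective dynamic*, at each time step a hopeful node is selected uniformly at random and its colour is changed, until there is no hopeful node (the ring has *finished*). The scenario $(\rho,\tau_g,\tau_r)$ is *static almost everywhere* if for every $\varepsilon>0$ there is $w_0$ such that for every $w\ge w_0$ there is $n_0$ such that for all $n\ge n_0$ a node chosen uniformly at random has probability less than $\varepsilon$ of changing colour at any stage before the ring finishes. An interval $J$ of $w+1$ consecutive nodes is *green intractable* if it contains fewer than $\tau_g(2w+1)-(w+1)$ green nodes, and *red intractable* if it contains fewer than $\tau_r(2w+1)-(w+1)$ red nodes. **Thresholds.** Let $g(x)=\dfrac{(x-\frac12)^{2x-1}}{x^{2x}}$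 for $\frac12<x<1$; it is strictly decreasing. Let $\mu^\rho_g$ be the root of $g(x)=\frac1{2\rho}$ in $(\frac12,1)$ if it exists (that is, if $\rho>\frac14$), and $\mu^\rho_g=\frac12$ otherwise. Let $\mu^\rho_r$ be the root of $g(x)=\frac1{2(1-\rho)}$ in $(\frac12,1)$ if it exists (that is, if $\rho<\frac34$), and $\mu^\rho_r=\frac12$ otherwise. **Theorem.** Suppose $\mu^\rho_g<\tau_g$ and $\mu^\rho_r<\tau_r$. Then, under the selective dynamic, the scenario $(\rho,\tau_g,\tau_r)$ is static almost everywhere. Moreover, intractable intervals are exponentially more frequent than hopeful nodes in the initial configuration: let $F_r$ (respectively $F_g$) be the conditional probability that a given node is hopeful, given that it is red (green), and let $T_g$ (respectively $T_r$) be the probability that a given interval of $w+1$ consecutive nodes is green (red) intractable. Then there are $\zeta_g,\zeta_r\in(0,1)$ such that, for all sufficiently large $w$ and all $n\ge 2w+1$, $$F_r<\zeta_g^{\,w}\,T_g\qquad\text{and}\qquad F_g<\zeta_r^{\,w}\,T_r .$$ -/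

import Mathlib

open MeasureTheory ProbabilityTheory

namespace Schelling

/-- A configuration of the ring of `n` nodes: `true` means green, `false` means red. -/
abbrev Config (n : ℕ) : Type := ZMod n → Bool

/-- The interval of `k + 1` consecutive nodes `a, a + 1, …, a + k` of the ring. -/
def interval {n : ℕ} (a : ZMod n) (k : ℕ) : Finset (ZMod n) :=
  (Finset.range (k + 1)).image (fun i : ℕ => a + (i : ZMod n))

/-- The neighbourhood `[x - w, x + w]` of the node `x`. -/
def nbhd {n : ℕ} (w : ℕ) (x : ZMod n) : Finset (ZMod n) :=
  interval (x - (w : ZMod n)) (2 * w)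

/-- The number of green nodes in `A`. -/
def greenCount {n : ℕ} (σ : Config n) (A : Finset (ZMod n)) : ℕ :=
  (A.filter (fun y => σ y = true)).card

/-- The number of red nodes in `A`. -/
def redCount {n : ℕ} (σ : Config n) (A : Finset (ZMod n)) : ℕ :=
  (A.filter (fun y => σ y = false)).card

/-- A green (red) node is happy if there are at least `τg (2w+1)` green (`τr (2w+1)` red) nodes
in its neighbourhood. -/
def Happy {n : ℕ} (w : ℕ) (τg τr : ℝ) (σ : Config n) (x : ZMod n) : Prop :=
  (σ x = true → τg * (2 * w + 1) ≤ greenCount σ (nbhd w x)) ∧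
  (σ x = false → τr * (2 * w + 1) ≤ redCount σ (nbhd w x))

/-- The configuration obtained from `σ` by changing the colour of the node `x`. -/
def recolour {n : ℕ} (σ : Config n) (x : ZMod n) : Config n :=
  Function.update σ x (!(σ x))

/-- A node is hopeful if it is unhappy, but a change of its colour would cause it to be happy. -/
def Hopeful {n : ℕ} (w : ℕ) (τg τr : ℝ) (σ : Config n) (x : ZMod n) : Prop :=
  ¬ Happy w τg τr σ x ∧ Happy w τg τr (recolour σ x) x

/-- The interval `[a, a + w]`, of length `w + 1`, is green intractable: it contains fewer than
`τg (2w+1) - (w+1)` green nodes. -/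
def GreenIntractable {n : ℕ} (w : ℕ) (τg : ℝ) (σ : Config n) (a : ZMod n) : Prop :=
  (greenCount σ (interval a w) : ℝ) < τg * (2 * w + 1) - (w + 1)

/-- The interval `[a, a + w]`, of length `w + 1`, is red intractable: it contains fewer than
`τr (2w+1) - (w+1)` red nodes. -/
def RedIntractable {n : ℕ} (w : ℕ) (τr : ℝ) (σ : Config n) (a : ZMod n) : Prop :=
  (redCount σ (interval a w) : ℝ) < τr * (2 * w + 1) - (w + 1)

section Dynamics

variable {n : ℕ} [NeZero n]

open scoped Classical in
/-- The set of all hopeful nodes. -/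
noncomputable def hopefulNodes (w : ℕ) (τg τr : ℝ) (σ : Config n) : Finset (ZMod n) :=
  Finset.univ.filter (fun x => Hopeful w τg τr σ x)

open scoped Classical in
/-- One time step of the selective dynamic: a hopeful node is selected uniformly at random and its
colour is changed; if there is no hopeful node, the process has finished and nothing moves. -/
noncomputable def selectiveStep (w : ℕ) (τg τr : ℝ) (σ : Config n) : PMF (Config n) :=
  if h : (hopefulNodes w τg τr σ).Nonempty then
    (PMF.uniformOfFinset (hopefulNodes w τg τr σ) h).map (recolour σ)
  else PMF.pure σ

/-- The transition kernel of the selective dynamic from the history up to time `t` to the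
configuration at time `t + 1`. It only depends on the configuration at time `t`. -/
noncomputable def selectiveKernel (n : ℕ) [NeZero n] (w : ℕ) (τg τr : ℝ) (t : ℕ) :
    Kernel ((i : Finset.Iic t) → Config n) (Config n) :=
  Kernel.ofFunOfCountable fun hist =>
    (selectiveStep w τg τr (hist ⟨t, Finset.mem_Iic.2 le_rfl⟩)).toMeasure

instance (w : ℕ) (τg τr : ℝ) (t : ℕ) : IsMarkovKernel (selectiveKernel n w τg τr t) :=
  ⟨fun _ => PMF.toMeasure.isProbabilityMeasure _⟩

/-- The law of the initial configuration: the nodes are independent, each being green with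
probability `ρ` and red with probability `1 - ρ`. -/
noncomputable def initialLaw (n : ℕ) [NeZero n] (ρ : ℝ) : Measure (Config n) :=
  Measure.pi fun _ : ZMod n =>
    ENNReal.ofReal ρ • Measure.dirac true + ENNReal.ofReal (1 - ρ) • Measure.dirac false

/-- The law, on sequences of configurations indexed by time, of the selective dynamic started
from the random initial configuration. -/
noncomputable def selectiveLaw (n : ℕ) [NeZero n] (w : ℕ) (ρ τg τr : ℝ) :
    Measure (ℕ → Config n) :=
  Kernel.trajMeasure (X := fun _ => Config n) (initialLaw n ρ) (selectiveKernel n w τg τr)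

theorem isProbabilityMeasure_initialLaw (n : ℕ) [NeZero n] (ρ : ℝ) (h0 : 0 ≤ ρ) (h1 : ρ ≤ 1) :
    IsProbabilityMeasure (initialLaw n ρ) := by
  have : IsProbabilityMeasure
      (ENNReal.ofReal ρ • Measure.dirac true + ENNReal.ofReal (1 - ρ) • Measure.dirac false) := by
    refine ⟨?_⟩
    rw [Measure.add_apply, Measure.smul_apply, Measure.smul_apply, measure_univ, measure_univ,
      smul_eq_mul, smul_eq_mul, mul_one, mul_one, ← ENNReal.ofReal_add h0 (by linarith)]
    simp
  unfold initialLaw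
  infer_instance

theorem isProbabilityMeasure_selectiveLaw (n : ℕ) [NeZero n] (w : ℕ) (ρ τg τr : ℝ)
    (h0 : 0 ≤ ρ) (h1 : ρ ≤ 1) : IsProbabilityMeasure (selectiveLaw n w ρ τg τr) := by
  have := isProbabilityMeasure_initialLaw n ρ h0 h1
  unfold selectiveLaw
  infer_instance

/-- The probability that a node chosen uniformly at random (independently of the process) changes
colour at some stage under the selective dynamic. Once the ring has finished, the configuration
stays constant, so that every change happens before the ring finishes. -/
noncomputable def changeProb (n : ℕ) [NeZero n] (w : ℕ) (ρ τg τr : ℝ) : ENNReal :=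
  ∑ x : ZMod n, PMF.uniformOfFintype (ZMod n) x *
    selectiveLaw n w ρ τg τr {path | ∃ t : ℕ, path (t + 1) x ≠ path t x}

/-- The probability, in the initial configuration, that the node `x` is hopeful given that it is
red. -/
noncomputable def hopefulRedProb (n : ℕ) [NeZero n] (w : ℕ) (ρ τg τr : ℝ) (x : ZMod n) : ℝ :=
  (cond (initialLaw n ρ) {σ | σ x = false}).real {σ | Hopeful w τg τr σ x}

/-- The probability, in the initial configuration, that the node `x` is hopeful given that it is
green. -/
noncomputable def hopefulGreenProb (n : ℕ) [NeZero n] (w : ℕ) (ρ τg τr : ℝ) (x : ZMod n) : ℝ :=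
  (cond (initialLaw n ρ) {σ | σ x = true}).real {σ | Hopeful w τg τr σ x}

/-- The probability, in the initial configuration, that `[a, a + w]` is green intractable. -/
noncomputable def greenIntractableProb (n : ℕ) [NeZero n] (w : ℕ) (ρ τg : ℝ) (a : ZMod n) : ℝ :=
  (initialLaw n ρ).real {σ | GreenIntractable w τg σ a}

/-- The probability, in the initial configuration, that `[a, a + w]` is red intractable. -/
noncomputable def redIntractableProb (n : ℕ) [NeZero n] (w : ℕ) (ρ τr : ℝ) (a : ZMod n) : ℝ :=
  (initialLaw n ρ).real {σ | RedIntractable w τr σ a}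

end Dynamics

/-- The scenario `(ρ, τg, τr)` is static almost everywhere under the selective dynamic: for every
`ε > 0`, all sufficiently large `w` and all `n` sufficiently large compared to `w`, a node chosen
uniformly at random changes colour with probability below `ε`. -/
def StaticAlmostEverywhere (ρ τg τr : ℝ) : Prop :=
  ∀ ε : ℝ, 0 < ε → ∃ w₀ : ℕ, ∀ w : ℕ, w₀ ≤ w → ∃ n₀ : ℕ, ∀ (n : ℕ) [NeZero n], n₀ ≤ n →
    changeProb n w ρ τg τr < ENNReal.ofReal ε

/-- The function `g` whose level sets determine the thresholds. -/
noncomputable def thresholdFn (x : ℝ) : ℝ :=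
  (x - 1 / 2) ^ (2 * x - 1) / x ^ (2 * x)

/-- `x` is a root of `g(x) = 1 / (2p)` in `(1/2, 1)`. -/
def IsThresholdRoot (p x : ℝ) : Prop :=
  1 / 2 < x ∧ x < 1 ∧ thresholdFn x = 1 / (2 * p)

theorem thresholdFn_eq_exp {x : ℝ} (h : 1 / 2 ≤ x) :
    thresholdFn x = Real.exp (2 * ((x - 1 / 2) * Real.log (x - 1 / 2)) -
      2 * (x * Real.log x)) := by
  have hx : 0 < x := by linarith
  unfold thresholdFn
  rw [Real.exp_sub, Real.rpow_def_of_pos hx]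
  congr 1
  · rcases h.eq_or_lt with rfl | h
    · norm_num
    · rw [Real.rpow_def_of_pos (by linarith)]
      congr 1
      ring
  · congr 1
    ring

theorem thresholdFn_strictAntiOn : StrictAntiOn thresholdFn (Set.Ici (1 / 2)) := by
  set F : ℝ → ℝ := fun x => 2 * ((x - 1 / 2) * Real.log (x - 1 / 2)) - 2 * (x * Real.log x)
    with hF
  have key : StrictAntiOn F (Set.Ici (1 / 2)) := by
    apply strictAntiOn_of_deriv_neg (convex_Ici _)
    · apply Continuous.continuousOn
      have h1 : Continuous fun x : ℝ => (x - 1 / 2) * Real.log (x - 1 / 2) :=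
        Real.continuous_mul_log.comp (continuous_id.sub continuous_const)
      exact (h1.const_mul 2).sub (Real.continuous_mul_log.const_mul 2)
    · intro x hx
      rw [interior_Ici, Set.mem_Ioi] at hx
      have h1 : HasDerivAt (fun x : ℝ => (x - 1 / 2) * Real.log (x - 1 / 2))
          (Real.log (x - 1 / 2) + 1) x := by
        have := (Real.hasDerivAt_mul_log (x := x - 1 / 2) (by linarith)).comp x
          ((hasDerivAt_id x).sub_const (1 / 2))
        rw [mul_one] at this
        exact this
      have h2 := Real.hasDerivAt_mul_log (x := x) (by linarith)
      have h3 : HasDerivAt F (2 * (Real.log (x - 1 / 2) + 1) - 2 * (Real.log x + 1)) x :=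
        (h1.const_mul 2).sub (h2.const_mul 2)
      rw [h3.deriv]
      have : Real.log (x - 1 / 2) < Real.log x :=
        Real.log_lt_log (by linarith) (by linarith)
      linarith
  intro a ha b hb hab
  rw [thresholdFn_eq_exp ha, thresholdFn_eq_exp hb]
  exact Real.exp_lt_exp.2 (key ha hb hab)

/-- The root is unique, if it exists. -/
theorem IsThresholdRoot.unique {p x y : ℝ} (hx : IsThresholdRoot p x) (hy : IsThresholdRoot p y) :
    x = y :=
  thresholdFn_strictAntiOn.injOn hx.1.le hy.1.le (hx.2.2.trans hy.2.2.symm)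

/-- The root exists for `1/4 < p < 1`. -/
theorem exists_isThresholdRoot {p : ℝ} (h0 : 1 / 4 < p) (h1 : p < 1) :
    ∃ x, IsThresholdRoot p x := by
  have hcont : ContinuousOn thresholdFn (Set.Icc (1 / 2) 1) := by
    have h1 : Continuous fun x : ℝ => (x - 1 / 2) * Real.log (x - 1 / 2) :=
      Real.continuous_mul_log.comp (continuous_id.sub continuous_const)
    have h2 := Real.continuous_exp.comp
      ((h1.const_mul 2).sub (Real.continuous_mul_log.const_mul 2))
    exact h2.continuousOn.congr fun x hx => thresholdFn_eq_exp hx.1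
  have ha : thresholdFn (1 / 2) = 2 := by
    unfold thresholdFn
    norm_num
  have hb : thresholdFn 1 = 1 / 2 := by
    unfold thresholdFn
    norm_num
  have hp : 1 / (2 * p) ∈ Set.Ioo (thresholdFn 1) (thresholdFn (1 / 2)) := by
    rw [ha, hb]
    constructor
    · rw [div_lt_div_iff₀ (by norm_num) (by linarith)]
      linarith
    · rw [div_lt_iff₀ (by linarith)]
      linarith
  obtain ⟨x, hx, hgx⟩ := intermediate_value_Ioo' (by norm_num) hcont hp
  exact ⟨x, hx.1, hx.2, hgx⟩

open scoped Classical in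
/-- The root of `g(x) = 1 / (2p)` in `(1/2, 1)` if it exists, and `1/2` otherwise (which, for
`0 < p < 1`, is the case exactly when `p ≤ 1/4`). -/
noncomputable def threshold (p : ℝ) : ℝ :=
  if h : ∃ x, IsThresholdRoot p x then h.choose else 1 / 2

/-- The threshold `μ^ρ_g`. -/
noncomputable def muGreen (ρ : ℝ) : ℝ := threshold ρ

/-- The threshold `μ^ρ_r`. -/
noncomputable def muRed (ρ : ℝ) : ℝ := threshold (1 - ρ)

end Schelling

/-! Fix a colour `c` of probability `p` with threshold `τ`, and let `k = critCount τ w`, the largest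
integer strictly below `τ(2w+1)`. A node of the other colour can be hopeful only if at least `k` of
the `2w` other nodes in its neighbourhood have colour `c`, while an interval of `w+1` nodes
containing exactly `k-(w+1)` of colour `c` is intractable. Since `threshold p < τ` forces `p < τ`,
the count `k` lies past the mode, and the first event has probability at most `2w+1` times a single
binomial term. The second has a single binomial term as a lower bound. Both terms involve about
`(2-2τ)w` nodes of the other colour, so these contributions cancel, and by Stirling the logarithm of
the ratio divided by `w` tends to `log(2p g(τ))`, which is negative above the threshold
(`tendsto_log_ratio`, `exists_hopefulTail_lt`). This is the frequency claim.

For staticity, suppose that `x` lies in a window ending on both sides in intractable intervals, and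
that no node of colour `!c` in the window is initially hopeful. Then no node there ever turns to
`c`: changes inside the window can only lower the number of nodes of colour `c`, which makes turning
to `c` harder still (`not_change_of_shielded`). If `T` is the intractable term, about `w/T` blocks
on each side of `x` very probably include an intractable one, yet very probably contain no hopeful
node (`exists_block_number`, `initialLaw_real_exposed_le`). Applying this to both colours bounds the
chance that `x` ever changes. The dynamic enters only through its initial law and the fact that
almost every path consists of legal steps. -/

namespace Schelling

/-! ### Stirling asymptotics and the threshold function -/

open Filter Topology

/-- Stirling's formula at linear scale: subtracting `a log w` removes the only term of order `w log
w`, and the square-root factor is `O(log w)`. -/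
theorem log_factorial_asymptotics {a : ℕ → ℕ} {α : ℝ} (hα : 0 < α)
    (ha : Tendsto (fun w => (a w : ℝ) / w) atTop (𝓝 α)) :
    Tendsto (fun w : ℕ => (Real.log (a w).factorial - a w * Real.log w) / w) atTop
      (𝓝 (α * Real.log α - α)) := by
  have hw : Tendsto (fun w : ℕ => (w : ℝ)) atTop atTop := tendsto_natCast_atTop_atTop
  have hw1 : ∀ᶠ w : ℕ in atTop, (0 : ℝ) < w := hw.eventually_gt_atTop 0
  have haR : Tendsto (fun w => (a w : ℝ)) atTop atTop := by
    refine (Tendsto.pos_mul_atTop hα ha hw).congr' ?_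
    filter_upwards [hw1] with w h
    field_simp
  have haN : Tendsto a atTop atTop := tendsto_natCast_atTop_iff.1 haR
  have h1 : Tendsto (fun w : ℕ => Real.log (Stirling.stirlingSeq (a w)) / w) atTop (𝓝 0) := by
    have hpi : √Real.pi ≠ 0 := by positivity
    exact (((Real.continuousAt_log hpi).tendsto.comp
      Stirling.tendsto_stirlingSeq_sqrt_pi).comp haN).div_atTop hw
  have h2 : Tendsto (fun w : ℕ => Real.log (2 * a w) / w) atTop (𝓝 0) := by
    have hlog : Tendsto (fun x : ℝ => Real.log x / x) atTop (𝓝 0) :=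
      Real.isLittleO_log_id_atTop.tendsto_div_nhds_zero
    have h2a : Tendsto (fun w => 2 * (a w : ℝ)) atTop atTop := haR.const_mul_atTop two_pos
    have := (hlog.comp h2a).mul (ha.const_mul 2)
    rw [zero_mul] at this
    refine this.congr' ?_
    filter_upwards [hw1, haR.eventually_gt_atTop 0] with w h h'
    simp only [Function.comp]
    field_simp
  have h3 : Tendsto (fun w : ℕ => (a w : ℝ) / w * Real.log (a w / w)) atTop
      (𝓝 (α * Real.log α)) :=
    ha.mul ((Real.continuousAt_log hα.ne').tendsto.comp ha)
  have := ((h1.add (h2.const_mul (1 / 2))).add h3).sub ha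
  simp only [mul_zero, add_zero, zero_add] at this
  refine this.congr' ?_
  filter_upwards [hw1, haR.eventually_gt_atTop 0] with w h h'
  have hf := Stirling.log_stirlingSeq_formula (a w)
  rw [Real.log_div h'.ne' (Real.exp_pos _).ne', Real.log_exp] at hf
  rw [Real.log_div h'.ne' h.ne', hf]
  field_simp
  ring

/-- Monotonicity of `thresholdFn` handles the case of a root. Without one, `p ≤ 1/4`, and the value
`2` at `1/2` already gives the bound. -/
theorem threshold_spec {p τ : ℝ} (hp : p ∈ Set.Ioo (0 : ℝ) 1) (h : threshold p < τ) :
    1 / 2 < τ ∧ 2 * p * thresholdFn τ < 1 := by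
  have hp0 := hp.1
  by_cases hx : ∃ x, IsThresholdRoot p x
  · have ht : IsThresholdRoot p (threshold p) := by
      unfold threshold; rw [dif_pos hx]; exact hx.choose_spec
    have h1 := thresholdFn_strictAntiOn (Set.mem_Ici.2 ht.1.le)
      (Set.mem_Ici.2 (ht.1.trans h).le) h
    rw [ht.2.2, lt_div_iff₀ (by positivity)] at h1
    exact ⟨ht.1.trans h, by linarith⟩
  · have ht : threshold p = 1 / 2 := by unfold threshold; rw [dif_neg hx]
    rw [ht] at h
    have hp4 : p ≤ 1 / 4 := by
      by_contra hc
      exact hx (exists_isThresholdRoot (not_le.1 hc) hp.2)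
    have h1 := thresholdFn_strictAntiOn (Set.mem_Ici.2 le_rfl) (Set.mem_Ici.2 h.le) h
    have h2 : thresholdFn (1 / 2) = 2 := by unfold thresholdFn; norm_num
    rw [h2] at h1
    refine ⟨h, ?_⟩
    nlinarith

/-- With `u = 2τ - 1` in `(0,1)`, `thresholdFn τ` is the inverse of `τ (1 + 1/u)^u`, and Bernoulli's
inequality gives `(1 + 1/u)^u ≤ 2`. -/
theorem one_le_two_mul_thresholdFn {τ : ℝ} (h : 1 / 2 < τ) (h1 : τ < 1) :
    1 ≤ 2 * τ * thresholdFn τ := by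
  set u := 2 * τ - 1 with hu
  have hu0 : 0 < u := by linarith
  have hb : (1 + 1 / u) ^ u ≤ 1 + u * (1 / u) :=
    rpow_one_add_le_one_add_mul_self (by have : 0 < 1 / u := by positivity
                                         linarith) hu0.le (by linarith)
  have e1 : 1 + u * (1 / u) = 2 := by field_simp; norm_num
  rw [e1] at hb
  have ht : thresholdFn τ = (τ * (1 + 1 / u) ^ u)⁻¹ := by
    have hτ : 0 < τ := by linarith
    have e2 : τ - 1 / 2 = τ * (1 + 1 / u)⁻¹ := by
      have : τ = (u + 1) / 2 := by rw [hu]; ring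
      rw [this]; field_simp; ring
    have e3 : 2 * τ = u + 1 := by rw [hu]; ring
    unfold thresholdFn
    rw [← hu, e2, e3, Real.mul_rpow hτ.le (by positivity), Real.inv_rpow (by positivity),
      Real.rpow_add hτ, Real.rpow_one]
    have : 0 < τ ^ u := by positivity
    have : 0 < (1 + 1 / u) ^ u := by positivity
    field_simp
  have hτ : 0 < τ := by linarith
  have : 0 < (1 + 1 / u) ^ u := by positivity
  rw [ht]
  rw [← div_eq_mul_inv, le_div_iff₀ (by positivity)]
  nlinarith

/-- If `τ ≤ p`, then `1 ≤ 2τ g(τ) ≤ 2p g(τ)`, against `threshold_spec`. This is what places the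
critical count past the binomial mode. -/
theorem lt_of_threshold_lt {p τ : ℝ} (hp : p ∈ Set.Ioo (0 : ℝ) 1) (hτ : τ < 1)
    (h : threshold p < τ) : p < τ := by
  obtain ⟨h1, h2⟩ := threshold_spec hp h
  by_contra hc
  have h3 := one_le_two_mul_thresholdFn h1 hτ
  have h4 : 0 ≤ thresholdFn τ := by
    unfold thresholdFn
    have : 0 < τ - 1 / 2 := by linarith
    positivity
  nlinarith [mul_le_mul_of_nonneg_right (not_lt.1 hc) h4]

/-! ### Binomial tails and the exponential comparison -/

/-- The probability that a binomial variable with parameters `N` and `p` equals `i`. -/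
noncomputable def binomTerm (p : ℝ) (N i : ℕ) : ℝ := N.choose i * p ^ i * (1 - p) ^ (N - i)

theorem binomTerm_nonneg {p : ℝ} (h0 : 0 ≤ p) (h1 : p ≤ 1) (N i : ℕ) : 0 ≤ binomTerm p N i := by
  have : 0 ≤ 1 - p := by linarith
  unfold binomTerm; positivity

theorem binomTerm_le_one {p : ℝ} (h0 : 0 ≤ p) (h1 : p ≤ 1) (N i : ℕ) : binomTerm p N i ≤ 1 := by
  rcases le_or_gt i N with h | h
  · have := add_pow p (1 - p) N
    rw [add_sub_cancel, one_pow] at this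
    rw [this]
    refine le_trans (le_of_eq ?_) (Finset.single_le_sum
      (f := fun m => p ^ m * (1 - p) ^ (N - m) * (N.choose m : ℝ)) (fun j _ => ?_)
      (Finset.mem_range.2 (Nat.lt_succ_of_le h)))
    · unfold binomTerm; ring
    · have : 0 ≤ 1 - p := by linarith
      positivity
  · simp [binomTerm, Nat.choose_eq_zero_of_lt h]

theorem binomTerm_succ_le {p : ℝ} (h0 : 0 < p) (h1 : p < 1) {N i : ℕ}
    (h : (N + 1) * p ≤ i + 1) : binomTerm p N (i + 1) ≤ binomTerm p N i := by
  rcases lt_or_ge i N with hi | hi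
  · unfold binomTerm
    obtain ⟨d, rfl⟩ : ∃ d, N = i + 1 + d := ⟨N - (i + 1), by omega⟩
    have e1 : i + 1 + d - (i + 1) = d := by omega
    have e2 : i + 1 + d - i = d + 1 := by omega
    rw [e1, e2]
    have hc : ((i + 1 + d).choose (i + 1) : ℝ) * (i + 1) = (i + 1 + d).choose i * (d + 1) := by
      have := Nat.choose_succ_right_eq (i + 1 + d) i
      rw [e2] at this
      exact_mod_cast this
    push_cast at h
    have hc0 : (0 : ℝ) ≤ (i + 1 + d).choose i := by positivity
    have key : ((i + 1 + d).choose (i + 1) : ℝ) * p ≤ (i + 1 + d).choose i * (1 - p) := by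
      have hi : (0 : ℝ) < i + 1 := by positivity
      refine le_of_mul_le_mul_right ?_ hi
      calc _ = ((i + 1 + d).choose (i + 1) : ℝ) * (i + 1) * p := by ring
        _ = (i + 1 + d).choose i * ((d + 1) * p) := by rw [hc]; ring
        _ ≤ (i + 1 + d).choose i * ((1 - p) * (i + 1)) :=
          mul_le_mul_of_nonneg_left (by linarith) hc0
        _ = _ := by ring
    have hq : 0 < 1 - p := by linarith
    calc _ = ((i + 1 + d).choose (i + 1) : ℝ) * p * (p ^ i * (1 - p) ^ d) := by ring
      _ ≤ (i + 1 + d).choose i * (1 - p) * (p ^ i * (1 - p) ^ d) := by gcongr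
      _ = _ := by ring
  · have : binomTerm p N (i + 1) = 0 := by
      simp [binomTerm, Nat.choose_eq_zero_of_lt (by omega : N < i + 1)]
    rw [this]
    exact binomTerm_nonneg h0.le h1.le _ _

/-- Past the mode the terms decrease, so the first one dominates the tail. -/
theorem sum_binomTerm_le {p : ℝ} (h0 : 0 < p) (h1 : p < 1) {N m : ℕ}
    (h : (N + 1) * p ≤ m + 1) :
    ∑ i ∈ Finset.Icc m N, binomTerm p N i ≤ (N + 1) * binomTerm p N m := by
  have hm : ∀ i, m ≤ i → binomTerm p N i ≤ binomTerm p N m := by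
    intro i hi
    induction i, hi using Nat.le_induction with
    | base => exact le_rfl
    | succ i hi ih =>
      refine (binomTerm_succ_le h0 h1 (h.trans ?_)).trans ih
      have : (m : ℝ) ≤ i := by exact_mod_cast hi
      linarith
  calc _ ≤ ∑ i ∈ Finset.Icc m N, binomTerm p N m :=
        Finset.sum_le_sum fun i hi => hm i (Finset.mem_Icc.1 hi).1
    _ = (N + 1 - m : ℕ) * binomTerm p N m := by simp
    _ ≤ _ := by
      have : ((N + 1 - m : ℕ) : ℝ) ≤ N + 1 := by exact_mod_cast Nat.sub_le _ _
      have := binomTerm_nonneg h0.le h1.le N m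
      gcongr

/-- The least number of nodes of the other colour that make a node unhappy but hopeful. -/
noncomputable def critCount (τ : ℝ) (w : ℕ) : ℕ := ⌈τ * (2 * w + 1)⌉₊ - 1

theorem le_critCount_add_one (τ : ℝ) (w : ℕ) : τ * (2 * w + 1) ≤ critCount τ w + 1 := by
  unfold critCount
  refine (Nat.le_ceil _).trans ?_
  have : ⌈τ * (2 * w + 1)⌉₊ ≤ ⌈τ * (2 * w + 1)⌉₊ - 1 + 1 := by omega
  exact_mod_cast this

/-- Together with `le_critCount_add_one` this makes one integer serve both purposes: the smallest
count allowing hope, and, after subtracting `w+1`, the largest intractable count. -/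
theorem critCount_lt {τ : ℝ} (h : 0 < τ) (w : ℕ) : (critCount τ w : ℝ) < τ * (2 * w + 1) := by
  have h0 : 0 < τ * (2 * w + 1) := by positivity
  have h1 : 0 < ⌈τ * (2 * w + 1)⌉₊ := Nat.ceil_pos.2 h0
  have h2 := Nat.ceil_lt_add_one h0.le
  unfold critCount
  rw [Nat.cast_sub (by omega : 1 ≤ ⌈τ * (2 * w + 1)⌉₊)]
  push_cast
  linarith

theorem critCount_le_of_le {τ : ℝ} {w k : ℕ} (h : τ * (2 * w + 1) ≤ k + 1) :
    critCount τ w ≤ k := by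
  have : ⌈τ * (2 * w + 1)⌉₊ ≤ k + 1 := Nat.ceil_le.2 (by push_cast; exact h)
  unfold critCount; omega

theorem tendsto_critCount {τ : ℝ} (h : 0 < τ) :
    Tendsto (fun w : ℕ => (critCount τ w : ℝ) / w) atTop (𝓝 (2 * τ)) := by
  have hw : Tendsto (fun w : ℕ => (w : ℝ)) atTop atTop := tendsto_natCast_atTop_atTop
  have h1 : Tendsto (fun w : ℕ => 2 * τ + (τ - 1) / w) atTop (𝓝 (2 * τ)) := by
    simpa using (tendsto_const_nhds (x := 2 * τ)).add (tendsto_const_nhds.div_atTop hw)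
  have h2 : Tendsto (fun w : ℕ => 2 * τ + τ / w) atTop (𝓝 (2 * τ)) := by
    simpa using (tendsto_const_nhds (x := 2 * τ)).add (tendsto_const_nhds.div_atTop hw)
  refine tendsto_of_tendsto_of_tendsto_of_le_of_le' h1 h2 ?_ ?_
  · filter_upwards [hw.eventually_gt_atTop 0] with w hw
    rw [le_div_iff₀ hw]
    have := le_critCount_add_one τ w
    field_simp
    linarith
  · filter_upwards [hw.eventually_gt_atTop 0] with w hw
    rw [div_le_iff₀ hw]
    have := critCount_lt h w
    field_simp
    linarith

/-- The probability that a node of the other colour sees enough nodes of the colour of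
probability `p` to be hopeful. -/
noncomputable def hopefulTail (p τ : ℝ) (w : ℕ) : ℝ :=
  ∑ i ∈ Finset.Icc (critCount τ w) (2 * w), binomTerm p (2 * w) i

/-- The probability that an interval of `w + 1` nodes contains exactly the largest number of nodes
of the colour of probability `p` for which it is intractable. -/
noncomputable def intractableTerm (p τ : ℝ) (w : ℕ) : ℝ :=
  binomTerm p (w + 1) (critCount τ w - (w + 1))

theorem eventually_critCount_bounds {τ : ℝ} (h : 1 / 2 < τ) (h1 : τ < 1) :
    ∀ᶠ w : ℕ in atTop, w + 1 ≤ critCount τ w ∧ critCount τ w ≤ 2 * w := by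
  have hlim := tendsto_critCount (τ := τ) (by linarith)
  have hw : Tendsto (fun w : ℕ => (w : ℝ)) atTop atTop := tendsto_natCast_atTop_atTop
  filter_upwards [hlim.eventually (lt_mem_nhds (by linarith : (1 : ℝ) < 2 * τ)),
    hlim.eventually (gt_mem_nhds (by linarith : 2 * τ < 2)), hw.eventually_gt_atTop 0]
    with w h1 h2 h3
  rw [lt_div_iff₀ h3] at h1
  rw [div_lt_iff₀ h3] at h2
  have h1' : w < critCount τ w := by rw [one_mul] at h1; exact_mod_cast h1
  have h2' : critCount τ w < 2 * w := by exact_mod_cast h2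
  omega

theorem binomTerm_log {p : ℝ} (h0 : 0 < p) (h1 : p < 1) {N i : ℕ} (h : i ≤ N) :
    Real.log (binomTerm p N i) = Real.log N.factorial - Real.log i.factorial
      - Real.log (N - i).factorial + i * Real.log p + (N - i : ℕ) * Real.log (1 - p) := by
  have hq : 0 < 1 - p := by linarith
  have hc : ((N.choose i : ℕ) : ℝ) = N.factorial / (i.factorial * (N - i).factorial) :=
    Nat.cast_choose ℝ h
  unfold binomTerm
  rw [hc, Real.log_mul (by positivity) (by positivity), Real.log_mul (by positivity) (by positivity),
    Real.log_div (by positivity) (by positivity), Real.log_mul (by positivity) (by positivity),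
    Real.log_pow, Real.log_pow]
  ring

theorem binomTerm_pos {p : ℝ} (h0 : 0 < p) (h1 : p < 1) {N i : ℕ} (h : i ≤ N) :
    0 < binomTerm p N i := by
  have hq : 0 < 1 - p := by linarith
  have := Nat.choose_pos h
  unfold binomTerm; positivity

theorem log_two_mul_thresholdFn {p τ : ℝ} (hp : 0 < p) (h : 1 / 2 < τ) :
    Real.log (2 * p * thresholdFn τ) =
      Real.log p + 2 * Real.log 2 - 2 * τ * Real.log (2 * τ)
        + (2 * τ - 1) * Real.log (2 * τ - 1) := by
  have e : 2 * τ - 1 = 2 * (τ - 1 / 2) := by ring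
  have h1 : 0 < τ - 1 / 2 := by linarith
  rw [thresholdFn_eq_exp h.le, Real.log_mul (by positivity) (Real.exp_pos _).ne', Real.log_exp,
    e, Real.log_mul two_ne_zero h1.ne', Real.log_mul two_ne_zero hp.ne',
    Real.log_mul (x := 2) (y := τ) two_ne_zero (by linarith)]
  ring

theorem tendsto_log_ratio {p τ : ℝ} (hp0 : 0 < p) (hp1 : p < 1) (h : 1 / 2 < τ) (h1 : τ < 1) :
    Tendsto (fun w : ℕ => (Real.log ((2 * w + 1) * binomTerm p (2 * w) (critCount τ w))
      - Real.log (intractableTerm p τ w)) / w) atTop (𝓝 (Real.log (2 * p * thresholdFn τ))) := by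
  have hw : Tendsto (fun w : ℕ => (w : ℝ)) atTop atTop := tendsto_natCast_atTop_atTop
  have hw1 : ∀ᶠ w : ℕ in atTop, (0 : ℝ) < w := hw.eventually_gt_atTop 0
  have hm := tendsto_critCount (τ := τ) (by linarith)
  have hb := eventually_critCount_bounds h h1
  have hinv : Tendsto (fun w : ℕ => (1 : ℝ) / w) atTop (𝓝 0) :=
    tendsto_const_nhds.div_atTop hw
  have a1 : Tendsto (fun w : ℕ => ((2 * w : ℕ) : ℝ) / w) atTop (𝓝 2) := by
    refine tendsto_const_nhds.congr' ?_
    filter_upwards [hw1] with w h; push_cast; field_simp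
  have a2 : Tendsto (fun w : ℕ => ((2 * w - critCount τ w : ℕ) : ℝ) / w) atTop
      (𝓝 (2 - 2 * τ)) := by
    refine (tendsto_const_nhds.sub hm).congr' ?_
    filter_upwards [hw1, hb] with w h hb
    rw [Nat.cast_sub hb.2]; push_cast; field_simp
  have a3 : Tendsto (fun w : ℕ => ((w + 1 : ℕ) : ℝ) / w) atTop (𝓝 1) := by
    have := hinv.const_add 1
    rw [add_zero] at this
    refine this.congr' ?_
    filter_upwards [hw1] with w h; push_cast; field_simp
  have a4 : Tendsto (fun w : ℕ => ((critCount τ w - (w + 1) : ℕ) : ℝ) / w) atTop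
      (𝓝 (2 * τ - 1)) := by
    refine (hm.sub a3).congr' ?_
    filter_upwards [hw1, hb] with w h hb
    rw [Nat.cast_sub hb.1]; push_cast; field_simp
  have a5 : Tendsto (fun w : ℕ => ((w + 1 - (critCount τ w - (w + 1)) : ℕ) : ℝ) / w) atTop
      (𝓝 (2 - 2 * τ)) := by
    have := a3.sub a4
    rw [show (1 : ℝ) - (2 * τ - 1) = 2 - 2 * τ by ring] at this
    refine this.congr' ?_
    filter_upwards [hw1, hb] with w h hb
    rw [Nat.cast_sub (by omega : critCount τ w - (w + 1) ≤ w + 1)]; field_simp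
  have l1 := log_factorial_asymptotics two_pos a1
  have l2 := log_factorial_asymptotics (by linarith) a2
  have l3 := log_factorial_asymptotics one_pos a3
  have l4 := log_factorial_asymptotics (by linarith) a4
  have l5 := log_factorial_asymptotics (by linarith) a5
  have l6 := log_factorial_asymptotics (by linarith) hm
  have l7 : Tendsto (fun w : ℕ => Real.log (2 * w + 1) / w) atTop (𝓝 0) := by
    have hlog : Tendsto (fun x : ℝ => Real.log x / x) atTop (𝓝 0) :=
      Real.isLittleO_log_id_atTop.tendsto_div_nhds_zero
    have hA : Tendsto (fun w : ℕ => 2 * (w : ℝ) + 1) atTop atTop :=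
      tendsto_atTop_add_const_right _ _ (hw.const_mul_atTop two_pos)
    have := (hlog.comp hA).mul (hinv.const_add 2)
    rw [zero_mul] at this
    refine this.congr' ?_
    filter_upwards [hw1] with w h
    simp only [Function.comp]
    field_simp
  have l8 := a3.mul_const (Real.log p)
  -- The exponents of `1 - p` in the two terms are `2w - k` and `2w + 2 - k`, with `k` the critical
  -- count. Only the constant factor `(1 - p)^(-2)` survives, and it vanishes at this scale.
  have L := (l7.add ((l1.sub l6).sub l2)).sub ((l3.sub l4).sub l5) |>.add l8 |>.add
    ((hinv.const_mul (-2 * Real.log (1 - p))))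
  have e : (0 + (2 * Real.log 2 - 2 - (2 * τ * Real.log (2 * τ) - 2 * τ) -
      ((2 - 2 * τ) * Real.log (2 - 2 * τ) - (2 - 2 * τ))) -
      (1 * Real.log 1 - 1 - ((2 * τ - 1) * Real.log (2 * τ - 1) - (2 * τ - 1)) -
      ((2 - 2 * τ) * Real.log (2 - 2 * τ) - (2 - 2 * τ))) + 1 * Real.log p
      + -2 * Real.log (1 - p) * 0) = Real.log (2 * p * thresholdFn τ) := by
    rw [log_two_mul_thresholdFn hp0 h, Real.log_one]; ring
  rw [e] at L
  refine L.congr' ?_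
  filter_upwards [hw1, hb] with w h hb
  have hk : critCount τ w - (w + 1) ≤ w + 1 := by omega
  unfold intractableTerm
  rw [Real.log_mul (by positivity) (binomTerm_pos hp0 hp1 hb.2).ne', binomTerm_log hp0 hp1 hb.2,
    binomTerm_log hp0 hp1 hk, Nat.cast_sub hb.2, Nat.cast_sub hk, Nat.cast_sub hb.1]
  push_cast
  field_simp
  ring

theorem exists_hopefulTail_lt {p τ : ℝ} (hp : p ∈ Set.Ioo (0 : ℝ) 1) (hτ : τ < 1)
    (h : threshold p < τ) :
    ∃ ζ ∈ Set.Ioo (0 : ℝ) 1, ∃ w₀ : ℕ, ∀ w : ℕ, w₀ ≤ w →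
      w + 1 ≤ critCount τ w ∧ critCount τ w ≤ 2 * w ∧
      hopefulTail p τ w < ζ ^ w * intractableTerm p τ w := by
  obtain ⟨h1, h2⟩ := threshold_spec hp h
  have hpτ := lt_of_threshold_lt hp hτ h
  obtain ⟨hp0, hp1⟩ := hp
  have h3 := one_le_two_mul_thresholdFn h1 hτ
  have h4 : 0 < thresholdFn τ := by
    by_contra hc
    nlinarith [mul_nonneg (by linarith : (0 : ℝ) ≤ 2 * τ)
      (by linarith [not_lt.1 hc] : 0 ≤ -thresholdFn τ)]
  have hL : Real.log (2 * p * thresholdFn τ) < 0 := Real.log_neg (by positivity) h2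
  set L := Real.log (2 * p * thresholdFn τ)
  have hlim := tendsto_log_ratio hp0 hp1 h1 hτ
  have hw : Tendsto (fun w : ℕ => (w : ℝ)) atTop atTop := tendsto_natCast_atTop_atTop
  -- Giving up half of the limiting rate turns the limit into an inequality valid for all large `w`,
  -- with `ζ = exp(L/2)`.
  have hev := (hlim.eventually (gt_mem_nhds (by linarith : L < L / 2))).and
    ((eventually_critCount_bounds h1 hτ).and (hw.eventually_gt_atTop 0))
  obtain ⟨w₀, hw₀⟩ := eventually_atTop.1 hev
  have hζ : Real.exp (L / 2) < 1 := by
    rw [← Real.exp_zero]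
    exact Real.exp_lt_exp.2 (by linarith)
  refine ⟨Real.exp (L / 2), ⟨Real.exp_pos _, hζ⟩, w₀, fun w hw' => ?_⟩
  obtain ⟨hr, ⟨hb1, hb2⟩, hwpos⟩ := hw₀ w hw'
  refine ⟨hb1, hb2, ?_⟩
  have hpos := binomTerm_pos hp0 hp1 hb2
  have ht : 0 < intractableTerm p τ w := binomTerm_pos hp0 hp1 (by omega)
  have hS : hopefulTail p τ w ≤ (2 * w + 1) * binomTerm p (2 * w) (critCount τ w) := by
    have := sum_binomTerm_le (N := 2 * w) (m := critCount τ w) hp0 hp1 (by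
      -- Being past the mode amounts to `(2w+1)p ≤ (2w+1)τ`, hence the need for `p < τ`.
      refine le_trans ?_ (le_critCount_add_one τ w)
      push_cast
      nlinarith)
    push_cast at this
    exact this
  refine hS.trans_lt ?_
  rw [div_lt_iff₀ hwpos] at hr
  rw [← Real.log_lt_log_iff (by positivity) (by positivity),
    Real.log_mul (Real.exp_pos _ |>.ne' |> pow_ne_zero _) ht.ne', Real.log_pow, Real.log_exp]
  linarith

/-- With `m` close to `w / t`, the chance of missing an event of probability `t` in `m` independent
trials is at most `exp(-w)`, while `m (w+1) f` is at most a polynomial in `w` times `ζ^w`. -/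
theorem exists_block_number {f t : ℕ → ℝ} {ζ : ℝ} (hζ : ζ ∈ Set.Ioo (0 : ℝ) 1)
    {w₀ : ℕ} (ht0 : ∀ w, w₀ ≤ w → 0 < t w) (ht1 : ∀ w, w₀ ≤ w → t w ≤ 1)
    (hf : ∀ w, w₀ ≤ w → f w ≤ ζ ^ w * t w) {ε : ℝ} (hε : 0 < ε) :
    ∃ w₁ : ℕ, ∀ w, w₁ ≤ w → ∃ m : ℕ,
      (2 * (m * (w + 1)) + 1) * f w + 2 * (1 - t w) ^ m < ε := by
  have hz (k : ℕ) : Tendsto (fun w : ℕ => (w : ℝ) ^ k * ζ ^ w) atTop (𝓝 0) :=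
    tendsto_pow_const_mul_const_pow_of_lt_one k hζ.1.le hζ.2
  have hexp : Tendsto (fun w : ℕ => Real.exp (-(w : ℝ))) atTop (𝓝 0) :=
    Real.tendsto_exp_neg_atTop_nhds_zero.comp tendsto_natCast_atTop_atTop
  have hl := ((((hz 2).const_mul 2).add ((hz 1).const_mul 4)).add ((hz 0).const_mul 3)).add
    (hexp.const_mul 2)
  simp only [mul_zero, add_zero] at hl
  obtain ⟨w₁, hw₁⟩ := eventually_atTop.1 (hl.eventually (gt_mem_nhds hε))
  refine ⟨max w₀ w₁, fun w hw => ⟨⌈w / t w⌉₊, ?_⟩⟩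
  have hw0 := le_of_max_le_left hw
  have h0 := ht0 w hw0
  have h1 := ht1 w hw0
  have hfw := hf w hw0
  have hlt := hw₁ w (le_of_max_le_right hw)
  set m := ⌈w / t w⌉₊
  have hm1 : (w : ℝ) ≤ m * t w := by
    rw [← div_le_iff₀ h0]; exact Nat.le_ceil _
  have hm2 : m * t w ≤ w + 1 := by
    have := (Nat.ceil_lt_add_one (by positivity : 0 ≤ (w : ℝ) / t w)).le
    calc m * t w ≤ (w / t w + 1) * t w := by gcongr
      _ = w + t w := by field_simp
      _ ≤ w + 1 := by linarith
  have hA : (2 * (m * (w + 1)) + 1) * f w ≤ (2 * (w : ℝ) ^ 2 + 4 * w + 3) * ζ ^ w := by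
    have hζw : 0 < ζ ^ w := pow_pos hζ.1 _
    calc _ ≤ (2 * (m * (w + 1)) + 1) * (ζ ^ w * t w) := by gcongr
      _ = (2 * ((m * t w) * (w + 1)) + t w) * ζ ^ w := by ring
      _ ≤ (2 * ((w + 1) * (w + 1)) + 1) * ζ ^ w := by gcongr
      _ = _ := by ring
  have hB : (1 - t w) ^ m ≤ Real.exp (-(w : ℝ)) := by
    calc (1 - t w) ^ m ≤ Real.exp (-(t w)) ^ m := by
          gcongr
          linarith [Real.add_one_le_exp (-(t w))]
      _ = Real.exp (-(m * t w)) := by rw [← Real.exp_nat_mul]; congr 1; ring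
      _ ≤ _ := by gcongr
  simp only [pow_one, pow_zero, one_mul] at hlt
  nlinarith

end Schelling

/-! ### Deterministic behaviour of legal paths -/

namespace Schelling

/-- The number of nodes of colour `c` in `A`. -/
def colourCount {n : ℕ} (c : Bool) (σ : Config n) (A : Finset (ZMod n)) : ℕ :=
  (A.filter (fun y => σ y = c)).card

theorem colourCount_mono {n : ℕ} {c : Bool} {σ σ' : Config n} {A : Finset (ZMod n)}
    (h : ∀ y ∈ A, σ y = c → σ' y = c) : colourCount c σ A ≤ colourCount c σ' A :=
  Finset.card_le_card fun y hy => by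
    rw [Finset.mem_filter] at hy ⊢
    exact ⟨hy.1, h y hy.1 hy.2⟩

theorem colourCount_anti {n : ℕ} {c : Bool} {σ σ' : Config n} {A : Finset (ZMod n)}
    (h : ∀ y ∈ A, σ y = !c → σ' y = !c) : colourCount c σ' A ≤ colourCount c σ A :=
  colourCount_mono fun y hy h' => by
    have := h y hy
    revert this h'
    cases σ y <;> cases σ' y <;> cases c <;> simp

theorem mem_interval {n : ℕ} {a y : ZMod n} {k : ℕ} :
    y ∈ interval a k ↔ ∃ i : ℕ, i ≤ k ∧ a + i = y := by
  simp [interval]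

theorem card_interval_le {n : ℕ} (a : ZMod n) (k : ℕ) : (interval a k).card ≤ k + 1 :=
  Finset.card_image_le.trans (by simp)

theorem natCast_inj_of_lt {n i j : ℕ} (hi : i < n) (hj : j < n)
    (h : (i : ZMod n) = (j : ZMod n)) : i = j :=
  Nat.ModEq.eq_of_lt_of_lt ((ZMod.natCast_eq_natCast_iff _ _ _).1 h) hi hj

theorem card_interval {n k : ℕ} (a : ZMod n) (h : k + 1 ≤ n) : (interval a k).card = k + 1 := by
  unfold interval
  rw [Finset.card_image_of_injOn, Finset.card_range]
  intro i hi j hj hij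
  simp only [Finset.coe_range, Set.mem_Iio] at hi hj
  exact natCast_inj_of_lt (by omega) (by omega) (add_left_cancel hij)

theorem self_mem_nbhd {n : ℕ} (w : ℕ) (y : ZMod n) : y ∈ nbhd w y :=
  mem_interval.2 ⟨w, by omega, by ring⟩

theorem interval_subset_nbhd {n w : ℕ} {a y : ZMod n} (h : y ∈ interval a w) :
    interval a w ⊆ nbhd w y := by
  obtain ⟨i, hi, rfl⟩ := mem_interval.1 h
  intro z hz
  obtain ⟨j, hj, rfl⟩ := mem_interval.1 hz
  refine mem_interval.2 ⟨w + j - i, by omega, ?_⟩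
  rw [Nat.cast_sub (by omega)]
  push_cast
  ring

theorem colourCount_nbhd_le {n w : ℕ} (hn : w + 1 ≤ n) {a y : ZMod n} (h : y ∈ interval a w)
    (c : Bool) (σ : Config n) :
    colourCount c σ (nbhd w y) ≤ colourCount c σ (interval a w) + w := by
  have hs := interval_subset_nbhd h
  have h1 : (nbhd w y \ interval a w).card ≤ w := by
    rw [Finset.card_sdiff_of_subset hs, card_interval a hn]
    have := card_interval_le (y - (w : ZMod n)) (2 * w)
    unfold nbhd
    omega
  have h2 : (nbhd w y).filter (fun y => σ y = c) ⊆
      (interval a w).filter (fun y => σ y = c) ∪ (nbhd w y \ interval a w) := by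
    intro z hz
    rw [Finset.mem_filter] at hz
    by_cases hzI : z ∈ interval a w
    · exact Finset.mem_union_left _ (Finset.mem_filter.2 ⟨hzI, hz.2⟩)
    · exact Finset.mem_union_right _ (Finset.mem_sdiff.2 ⟨hz.1, hzI⟩)
  calc _ ≤ _ := Finset.card_le_card h2
    _ ≤ _ := Finset.card_union_le _ _
    _ ≤ _ := by unfold colourCount; omega

theorem happy_of_eq {n w : ℕ} {τ : Bool → ℝ} {c : Bool} {σ : Config n} {y : ZMod n}
    (h : σ y = c) : Happy w (τ true) (τ false) σ y ↔
      τ c * (2 * w + 1) ≤ colourCount c σ (nbhd w y) := by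
  cases c <;> simp [Happy, h, colourCount, greenCount, redCount]

theorem recolour_self {n : ℕ} (σ : Config n) (y : ZMod n) : recolour σ y y = !(σ y) := by
  simp [recolour]

theorem recolour_of_ne {n : ℕ} (σ : Config n) {y z : ZMod n} (h : z ≠ y) :
    recolour σ y z = σ z := by
  simp [recolour, h]

theorem colourCount_recolour {n : ℕ} {c : Bool} {σ : Config n} {y : ZMod n} (h : σ y = !c)
    {A : Finset (ZMod n)} (hy : y ∈ A) :
    colourCount c (recolour σ y) A = colourCount c σ A + 1 := by
  unfold colourCount
  have : A.filter (fun z => recolour σ y z = c) = insert y (A.filter (fun z => σ z = c)) := by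
    ext z
    by_cases hz : z = y
    · subst hz
      simp [hy, recolour_self, h]
    · simp [recolour_of_ne σ hz, hz]
  rw [this, Finset.card_insert_of_notMem]
  simp [h]

/-- The `+ 1` is the node itself, which joins colour `c` when it is recoloured. -/
theorem hopeful_iff {n w : ℕ} {τ : Bool → ℝ} {c : Bool} {σ : Config n} {y : ZMod n}
    (h : σ y = !c) : Hopeful w (τ true) (τ false) σ y ↔
      (colourCount (!c) σ (nbhd w y) : ℝ) < τ (!c) * (2 * w + 1) ∧
      τ c * (2 * w + 1) ≤ colourCount c σ (nbhd w y) + 1 := by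
  have h' : recolour σ y y = c := by rw [recolour_self, h, Bool.not_not]
  unfold Hopeful
  rw [happy_of_eq h, happy_of_eq h', not_le, colourCount_recolour h (self_mem_nbhd w y)]
  push_cast
  rfl

/-- The interval `[a, a + w]` contains too few nodes of colour `c` for any of its nodes to change
its colour to `c`. -/
def Intractable {n : ℕ} (w : ℕ) (τ : Bool → ℝ) (c : Bool) (σ : Config n) (a : ZMod n) : Prop :=
  (colourCount c σ (interval a w) : ℝ) < τ c * (2 * w + 1) - (w + 1)

/-- A set of nodes that is closed under taking neighbourhoods up to intractable intervals. -/
def Shielded {n : ℕ} (w : ℕ) (τ : Bool → ℝ) (c : Bool) (σ : Config n)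
    (G : Set (ZMod n)) : Prop :=
  ∀ y ∈ G, (∀ z ∈ nbhd w y, z ∈ G) ∨
    ∃ a, y ∈ interval a w ∧ (∀ z ∈ interval a w, z ∈ G) ∧ Intractable w τ c σ a

/-- A sequence of configurations in which each step changes the colour of one hopeful node, or
nothing. -/
def LegalPath {n : ℕ} (w : ℕ) (τ : Bool → ℝ) (path : ℕ → Config n) : Prop :=
  ∀ t, path (t + 1) = path t ∨ ∃ y, Hopeful w (τ true) (τ false) (path t) y ∧
    path (t + 1) = recolour (path t) y

/-- In a shielded set of nodes without hopeful nodes of the colour `!c`, no node ever changes its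
colour to `c`. -/
theorem not_change_of_shielded {n w : ℕ} (hn : w + 1 ≤ n) {τ : Bool → ℝ} {c : Bool}
    {path : ℕ → Config n} (hpath : LegalPath w τ path) {G : Set (ZMod n)}
    (hG : Shielded w τ c (path 0) G)
    (h0 : ∀ y ∈ G, path 0 y = !c → ¬ Hopeful w (τ true) (τ false) (path 0) y) (t : ℕ) :
    ∀ y ∈ G, path t y = !c → path (t + 1) y = !c := by
  -- Only hopeful nodes move, so it suffices to keep the nodes of colour `!c` in `G` from being
  -- hopeful. The invariant has two parts: no initial `!c` in `G` is lost, and nodes that became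
  -- `!c` later, with neighbourhood inside `G`, are happy.
  have stable : ∀ t, (∀ y ∈ G, path t y = !c → ¬ Hopeful w (τ true) (τ false) (path t) y) →
      ∀ y ∈ G, path t y = !c → path (t + 1) y = !c := by
    intro t ht y hy hyc
    rcases hpath t with h | ⟨z, hz, h⟩
    · rw [h, hyc]
    · have hne : y ≠ z := by
        rintro rfl
        exact ht y hy hyc hz
      rw [h, recolour_of_ne _ hne, hyc]
  have quiet : ∀ t, (∀ y ∈ G, path 0 y = !c → path t y = !c) →
      (∀ y ∈ G, (∀ z ∈ nbhd w y, z ∈ G) → path t y = !c → path 0 y ≠ !c →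
        τ (!c) * (2 * w + 1) ≤ colourCount (!c) (path t) (nbhd w y)) →
      ∀ y ∈ G, path t y = !c → ¬ Hopeful w (τ true) (τ false) (path t) y := by
    intro t i1 i2 y hy hyc hh
    rw [hopeful_iff hyc] at hh
    rcases hG y hy with hN | ⟨a, hya, haG, hI⟩
    · by_cases hy0 : path 0 y = !c
      -- Compared with time `0`, the neighbourhood has at least as many `!c` and at most as many
      -- `c`, so hope now would have been hope at the start.
      · refine h0 y hy hy0 ((hopeful_iff hy0).2 ⟨lt_of_le_of_lt ?_ hh.1, hh.2.trans ?_⟩)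
        · exact_mod_cast colourCount_mono fun z hz => i1 z (hN z hz)
        · have : colourCount c (path t) (nbhd w y) ≤ colourCount c (path 0) (nbhd w y) :=
            colourCount_anti fun z hz => i1 z (hN z hz)
          have : (colourCount c (path t) (nbhd w y) : ℝ) ≤ colourCount c (path 0) (nbhd w y) := by
            exact_mod_cast this
          linarith
      · exact absurd (i2 y hy hN hyc hy0) (not_le.2 hh.1)
    -- At most `w` nodes of the neighbourhood lie outside the interval; even if all have colour `c`,
    -- the count falls short.
    · have h1 := colourCount_nbhd_le hn hya c (path t)
      have h2 : colourCount c (path t) (interval a w) ≤ colourCount c (path 0) (interval a w) :=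
        colourCount_anti fun z hz => i1 z (haG z hz)
      have h3 : (colourCount c (path t) (nbhd w y) : ℝ) ≤
          colourCount c (path 0) (interval a w) + w := by
        exact_mod_cast h1.trans (by omega)
      have h4 := hh.2
      unfold Intractable at hI
      linarith
  have inv : ∀ t, (∀ y ∈ G, path 0 y = !c → path t y = !c) ∧
      (∀ y ∈ G, (∀ z ∈ nbhd w y, z ∈ G) → path t y = !c → path 0 y ≠ !c →
        τ (!c) * (2 * w + 1) ≤ colourCount (!c) (path t) (nbhd w y)) := by
    intro t
    induction t with
    | zero => exact ⟨fun _ _ h => h, fun _ _ _ h h' => absurd h h'⟩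
    | succ t ih =>
      have hs := stable t (quiet t ih.1 ih.2)
      refine ⟨fun y hy h => hs y hy (ih.1 y hy h), fun y hy hN hyc hy0 => ?_⟩
      by_cases hyt : path t y = !c
      · refine (ih.2 y hy hN hyt hy0).trans ?_
        exact_mod_cast colourCount_mono fun z hz => hs z (hN z hz)
      · rcases hpath t with h | ⟨z, hz, h⟩
        · rw [h] at hyc
          exact absurd hyc hyt
        -- A node that has just turned to `!c` was hopeful, so the move made it happy; afterwards
        -- its count of `!c` cannot drop.
        · have hyz : y = z := by
            by_contra hne
            rw [h, recolour_of_ne _ hne] at hyc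
            exact hyt hyc
          subst hyz
          rw [h] at hyc ⊢
          exact (happy_of_eq hyc).1 hz.2
  exact stable t (quiet t (inv t).1 (inv t).2)

/-! ### Windows bounded by intractable intervals -/

/-- The nodes `x - A, …, x + B`. -/
noncomputable def window {n : ℕ} (x : ZMod n) (A B : ℕ) : Finset (ZMod n) :=
  (Finset.Icc (-(A : ℤ)) B).image (fun i : ℤ => x + (i : ZMod n))

theorem mem_window {n : ℕ} {x y : ZMod n} {A B : ℕ} :
    y ∈ window x A B ↔ ∃ i : ℤ, -(A : ℤ) ≤ i ∧ i ≤ B ∧ x + i = y := by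
  simp [window, and_assoc]

theorem card_window_le {n : ℕ} (x : ZMod n) (A B : ℕ) : (window x A B).card ≤ A + B + 1 :=
  Finset.card_image_le.trans (by simp; omega)

/-- An offset within `w` of an end lies in the intractable block there; any other has its whole
neighbourhood in the window. Integer offsets make wrapping around the ring harmless. -/
theorem shielded_window {n w A B : ℕ} {τ : Bool → ℝ} {c : Bool} {σ : Config n}
    {x a b : ZMod n} (hA : w ≤ A) (hB : w ≤ B) (hxa : x - (A : ZMod n) = a)
    (hxb : x + (B : ZMod n) - (w : ZMod n) = b)
    (ha : Intractable w τ c σ a) (hb : Intractable w τ c σ b) :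
    Shielded w τ c σ (window x A B : Set (ZMod n)) := by
  subst hxa hxb
  intro y hy
  simp only [Finset.mem_coe, mem_window] at hy ⊢
  obtain ⟨i, hi1, hi2, rfl⟩ := hy
  by_cases h1 : i ≤ -(A : ℤ) + w
  · right
    refine ⟨_, mem_interval.2 ⟨(i + A).toNat, by omega, ?_⟩, ?_, ha⟩
    · have : (((i + A).toNat : ℕ) : ZMod n) = ((((i + A).toNat : ℕ) : ℤ) : ZMod n) := by
        push_cast; rfl
      rw [this, Int.toNat_of_nonneg (by omega)]
      push_cast
      ring
    · intro z hz
      obtain ⟨j, hj, rfl⟩ := mem_interval.1 hz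
      refine ⟨j - A, by omega, by omega, ?_⟩
      push_cast
      ring
  by_cases h2 : (B : ℤ) - w ≤ i
  · right
    refine ⟨_, mem_interval.2 ⟨(i - (B - w)).toNat, by omega, ?_⟩, ?_, hb⟩
    · have : (((i - (B - w)).toNat : ℕ) : ZMod n) = ((((i - (B - w)).toNat : ℕ) : ℤ) : ZMod n) := by
        push_cast; rfl
      rw [this, Int.toNat_of_nonneg (by omega)]
      push_cast
      ring
    · intro z hz
      obtain ⟨j, hj, rfl⟩ := mem_interval.1 hz
      refine ⟨B - w + j, by omega, by omega, ?_⟩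
      push_cast
      ring
  · left
    intro z hz
    obtain ⟨j, hj, rfl⟩ := mem_interval.1 hz
    refine ⟨i - w + j, by omega, by omega, ?_⟩
    push_cast
    ring

/-- Some node of colour `!c` within distance `m (w + 1)` of `x` is hopeful, or the `m` disjoint
intervals to one side of `x` are all tractable. -/
def Exposed {n : ℕ} (w : ℕ) (τ : Bool → ℝ) (c : Bool) (m : ℕ) (x : ZMod n)
    (σ : Config n) : Prop :=
  (∃ y ∈ window x (m * (w + 1)) (m * (w + 1)), σ y = !c ∧ Hopeful w (τ true) (τ false) σ y) ∨
  (∀ k < m, ¬ Intractable w τ c σ (x + (k * (w + 1) : ℕ))) ∨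
  (∀ k < m, ¬ Intractable w τ c σ (x - (k * (w + 1) + w : ℕ)))

theorem not_change_of_not_exposed {n w m : ℕ} (hn : w + 1 ≤ n) {τ : Bool → ℝ} {c : Bool}
    {path : ℕ → Config n} (hpath : LegalPath w τ path) {x : ZMod n}
    (h : ¬ Exposed w τ c m x (path 0)) (t : ℕ) (hx : path t x = !c) : path (t + 1) x = !c := by
  unfold Exposed at h
  push Not at h
  obtain ⟨h1, ⟨k, hk, hI⟩, ⟨l, hl, hJ⟩⟩ := h
  have hkm : k * (w + 1) + w ≤ m * (w + 1) := by nlinarith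
  have hlm : l * (w + 1) + w ≤ m * (w + 1) := by nlinarith
  refine not_change_of_shielded hn hpath (G := window x (l * (w + 1) + w) (k * (w + 1) + w))
    (shielded_window (by omega) (by omega) rfl ?_ hJ hI) ?_ t x ?_ hx
  · push_cast; ring
  · intro y hy
    obtain ⟨i, hi1, hi2, rfl⟩ := mem_window.1 (Finset.mem_coe.1 hy)
    exact h1 _ (mem_window.2 ⟨i, by omega, by omega, rfl⟩)
  · exact Finset.mem_coe.2 (mem_window.2 ⟨0, by omega, by omega, by simp⟩)

/-! ### Estimates for the initial configuration -/

/-- The probability of the colour `c`. -/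
noncomputable def colourProb (ρ : ℝ) (c : Bool) : ℝ := if c then ρ else 1 - ρ

theorem colourProb_not (ρ : ℝ) (c : Bool) : colourProb ρ (!c) = 1 - colourProb ρ c := by
  cases c <;> simp [colourProb]

theorem colourProb_mem {ρ : ℝ} (h : ρ ∈ Set.Ioo (0 : ℝ) 1) (c : Bool) :
    colourProb ρ c ∈ Set.Ioo (0 : ℝ) 1 := by
  obtain ⟨h0, h1⟩ := h
  cases c <;> simp [colourProb, h0, h1]

/-- The law of the colour of a single node. -/
noncomputable def nodeLaw (ρ : ℝ) : Measure Bool :=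
  ENNReal.ofReal ρ • Measure.dirac true + ENNReal.ofReal (1 - ρ) • Measure.dirac false

theorem nodeLaw_real_singleton {ρ : ℝ} (h : ρ ∈ Set.Ioo (0 : ℝ) 1) (c : Bool) :
    (nodeLaw ρ).real {c} = colourProb ρ c := by
  have h0 : 0 ≤ ρ := h.1.le
  have h1 : 0 ≤ 1 - ρ := by linarith [h.2]
  cases c <;> simp [nodeLaw, Measure.real, colourProb, h0, h.2.le]

theorem isProbabilityMeasure_nodeLaw {ρ : ℝ} (h : ρ ∈ Set.Ioo (0 : ℝ) 1) :
    IsProbabilityMeasure (nodeLaw ρ) := by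
  refine ⟨?_⟩
  unfold nodeLaw
  rw [Measure.add_apply, Measure.smul_apply, Measure.smul_apply, measure_univ, measure_univ,
    smul_eq_mul, smul_eq_mul, mul_one, mul_one, ← ENNReal.ofReal_add h.1.le (by linarith [h.2])]
  simp

/-- The event `E` only depends on the colours of the nodes in `A`. -/
def DeterminedBy {n : ℕ} (A : Finset (ZMod n)) (E : Set (Config n)) : Prop :=
  ∀ σ σ' : Config n, (∀ y ∈ A, σ y = σ' y) → σ ∈ E → σ' ∈ E

theorem disjoint_right_intervals {n w m i j : ℕ} (hn : m * (w + 1) ≤ n) (x : ZMod n) (hij : i < j)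
    (hj : j < m) : Disjoint (interval (x + ((i * (w + 1) : ℕ) : ZMod n)) w)
      (interval (x + ((j * (w + 1) : ℕ) : ZMod n)) w) := by
  rw [Finset.disjoint_left]
  intro y h1 h2
  obtain ⟨a, ha, rfl⟩ := mem_interval.1 h1
  obtain ⟨b, hb, he⟩ := mem_interval.1 h2
  rw [add_assoc, add_assoc, add_right_inj, ← Nat.cast_add, ← Nat.cast_add] at he
  have := natCast_inj_of_lt (by nlinarith) (by nlinarith) he
  nlinarith

theorem disjoint_left_intervals {n w m i j : ℕ} (hn : m * (w + 1) ≤ n) (x : ZMod n) (hij : i < j)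
    (hj : j < m) : Disjoint (interval (x - ((i * (w + 1) + w : ℕ) : ZMod n)) w)
      (interval (x - ((j * (w + 1) + w : ℕ) : ZMod n)) w) := by
  rw [Finset.disjoint_left]
  intro y h1 h2
  obtain ⟨a, ha, rfl⟩ := mem_interval.1 h1
  obtain ⟨b, hb, he⟩ := mem_interval.1 h2
  have he' : ((j * (w + 1) + w - b : ℕ) : ZMod n) = ((i * (w + 1) + w - a : ℕ) : ZMod n) := by
    rw [Nat.cast_sub (by omega), Nat.cast_sub (by omega)]
    linear_combination -he
  have h3 : j * (w + 1) + w - b < n := by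
    have : j * (w + 1) + w < n := by nlinarith
    omega
  have h4 : i * (w + 1) + w - a < n := by
    have : i * (w + 1) + w < n := by nlinarith
    omega
  have := natCast_inj_of_lt h3 h4 he'
  have : (i + 1) * (w + 1) ≤ j * (w + 1) := Nat.mul_le_mul_right _ hij
  have : i * (w + 1) + (w + 1) ≤ j * (w + 1) := by linarith
  omega

theorem determinedBy_not_intractable {n : ℕ} (w : ℕ) (τ : Bool → ℝ) (c : Bool) (a : ZMod n) :
    DeterminedBy (interval a w) {σ | ¬ Intractable w τ c σ a} := by
  intro σ σ' hs hσ
  have : colourCount c σ' (interval a w) = colourCount c σ (interval a w) := by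
    unfold colourCount
    congr 1
    exact Finset.filter_congr fun y hy => by rw [hs y hy]
  rw [Set.mem_ofPred_eq, Intractable, this]
  exact hσ

section

variable {n : ℕ} [NeZero n] {ρ : ℝ}

theorem initialLaw_real_filter_eq (h : ρ ∈ Set.Ioo (0 : ℝ) 1) (c : Bool)
    {A S : Finset (ZMod n)} (hS : S ⊆ A) :
    (initialLaw n ρ).real {σ | A.filter (fun y => σ y = c) = S} =
      colourProb ρ c ^ S.card * (1 - colourProb ρ c) ^ (A.card - S.card) := by
  have := isProbabilityMeasure_nodeLaw h
  have e : {σ : Config n | A.filter (fun y => σ y = c) = S} =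
      Set.pi Set.univ (fun y => if y ∈ S then {c} else if y ∈ A then {!c} else Set.univ) := by
    ext σ
    simp only [Set.mem_ofPred_eq, Set.mem_pi, Set.mem_univ, forall_true_left, Finset.ext_iff,
      Finset.mem_filter]
    refine forall_congr' fun y => ?_
    by_cases h1 : y ∈ S
    · simp [h1, hS h1]
    · by_cases h2 : y ∈ A
      · simp [h1, h2, Bool.eq_not]
      · simp [h1, h2]
  rw [e]
  have e2 : (initialLaw n ρ) = Measure.pi fun _ : ZMod n => nodeLaw ρ := rfl
  rw [e2, Measure.real, Measure.pi_pi, ENNReal.toReal_prod]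
  have e3 : ∀ y : ZMod n, (nodeLaw ρ (if y ∈ S then {c} else if y ∈ A then {!c}
      else Set.univ)).toReal = (if y ∈ S then colourProb ρ c else 1) *
        (if y ∈ A \ S then 1 - colourProb ρ c else 1) := by
    intro y
    by_cases h1 : y ∈ S
    · simpa [h1, Measure.real] using nodeLaw_real_singleton h c
    · by_cases h2 : y ∈ A
      · simpa [h1, h2, colourProb_not, Measure.real] using nodeLaw_real_singleton h (!c)
      · simp only [h1, h2, if_false, Finset.mem_sdiff, false_and, measure_univ,
          ENNReal.toReal_one, mul_one]
  simp_rw [e3]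
  rw [Finset.prod_mul_distrib, Finset.prod_ite_mem, Finset.prod_ite_mem, Finset.univ_inter,
    Finset.univ_inter, Finset.prod_const, Finset.prod_const, Finset.card_sdiff_of_subset hS]

/-- Two sets are allowed so that `A = B` gives the binomial law, while `B = insert x A` gives the
joint law of a count on `A` and the event that `x` has colour `!c`. -/
theorem initialLaw_real_exists_filter (h : ρ ∈ Set.Ioo (0 : ℝ) 1) (c : Bool)
    {A B : Finset (ZMod n)} (hA : A ⊆ B) (k : ℕ) :
    (initialLaw n ρ).real {σ | ∃ S ∈ A.powersetCard k, B.filter (fun y => σ y = c) = S} =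
      A.card.choose k * colourProb ρ c ^ k * (1 - colourProb ρ c) ^ (B.card - k) := by
  have := isProbabilityMeasure_initialLaw n ρ h.1.le h.2.le
  have e : {σ : Config n | ∃ S ∈ A.powersetCard k, B.filter (fun y => σ y = c) = S} =
      ⋃ S ∈ A.powersetCard k, {σ | B.filter (fun y => σ y = c) = S} := by
    ext σ; simp
  rw [e, measureReal_biUnion_finset _ (fun _ _ => .of_discrete)]
  · rw [Finset.sum_congr rfl (g := fun _ => colourProb ρ c ^ k *
      (1 - colourProb ρ c) ^ (B.card - k)), Finset.sum_const, Finset.card_powersetCard,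
      nsmul_eq_mul, mul_assoc]
    intro S hS
    rw [Finset.mem_powersetCard] at hS
    rw [initialLaw_real_filter_eq h c (hS.1.trans hA), hS.2]
  · intro S _ T _ hST
    rw [Function.onFun, Set.disjoint_left]
    intro σ h1 h2
    exact hST (h1.symm.trans h2)

theorem initialLaw_real_colourCount_eq (h : ρ ∈ Set.Ioo (0 : ℝ) 1) (c : Bool)
    (A : Finset (ZMod n)) (k : ℕ) :
    (initialLaw n ρ).real {σ | colourCount c σ A = k} = binomTerm (colourProb ρ c) A.card k := by
  rw [binomTerm, ← initialLaw_real_exists_filter h c (Finset.Subset.refl A) k]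
  congr 1
  ext σ
  simp [colourCount, Finset.mem_powersetCard]

theorem initialLaw_real_other_and_colourCount_eq (h : ρ ∈ Set.Ioo (0 : ℝ) 1) (c : Bool)
    {A : Finset (ZMod n)} {x : ZMod n} (hx : x ∉ A) (k : ℕ) :
    (initialLaw n ρ).real {σ | σ x = !c ∧ colourCount c σ A = k} =
      (1 - colourProb ρ c) * binomTerm (colourProb ρ c) A.card k := by
  have := initialLaw_real_exists_filter h c (Finset.subset_insert x A) k
  have e : {σ : Config n | ∃ S ∈ A.powersetCard k,
      (insert x A).filter (fun y => σ y = c) = S} = {σ | σ x = !c ∧ colourCount c σ A = k} := by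
    ext σ
    simp only [Set.mem_ofPred_eq, Finset.mem_powersetCard, colourCount]
    constructor
    · rintro ⟨S, ⟨h1, h2⟩, h3⟩
      have hxc : σ x = !c := by
        by_contra hne
        have : x ∈ S := by
          rw [← h3, Finset.mem_filter]
          exact ⟨Finset.mem_insert_self _ _, by simpa using hne⟩
        exact hx (h1 this)
      rw [Finset.filter_insert, if_neg (by simp [hxc])] at h3
      exact ⟨hxc, by rw [h3, h2]⟩
    · rintro ⟨h1, h2⟩
      refine ⟨_, ⟨Finset.filter_subset _ _, h2⟩, ?_⟩
      rw [Finset.filter_insert, if_neg (by simp [h1])]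
  rw [e] at this
  rw [this, Finset.card_insert_of_notMem hx]
  rcases le_or_gt k A.card with hk | hk
  · rw [show A.card + 1 - k = A.card - k + 1 by omega, binomTerm]
    ring
  · simp [binomTerm, Nat.choose_eq_zero_of_lt hk]

theorem initialLaw_real_node (h : ρ ∈ Set.Ioo (0 : ℝ) 1) (c : Bool) (x : ZMod n) :
    (initialLaw n ρ).real {σ | σ x = !c} = 1 - colourProb ρ c := by
  have := initialLaw_real_other_and_colourCount_eq h c (Finset.notMem_empty x) 0
  simpa [colourCount, binomTerm] using this

theorem initialLaw_real_hopeful_le (h : ρ ∈ Set.Ioo (0 : ℝ) 1) {w : ℕ} (hn : 2 * w + 1 ≤ n)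
    (τ : Bool → ℝ) (c : Bool) (x : ZMod n) :
    (initialLaw n ρ).real {σ | σ x = !c ∧ Hopeful w (τ true) (τ false) σ x} ≤
      (1 - colourProb ρ c) * hopefulTail (colourProb ρ c) (τ c) w := by
  have := isProbabilityMeasure_initialLaw n ρ h.1.le h.2.le
  set A := (nbhd w x).erase x with hA
  have hcard : A.card = 2 * w := by
    rw [hA, Finset.card_erase_of_mem (self_mem_nbhd w x), nbhd, card_interval _ hn]
    omega
  have hsub : {σ : Config n | σ x = !c ∧ Hopeful w (τ true) (τ false) σ x} ⊆
      ⋃ k ∈ Finset.Icc (critCount (τ c) w) (2 * w),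
        {σ | σ x = !c ∧ colourCount c σ A = k} := by
    rintro σ ⟨h1, h2⟩
    have hh := ((hopeful_iff h1).1 h2).2
    have hc : colourCount c σ (nbhd w x) = colourCount c σ A := by
      unfold colourCount
      rw [hA, Finset.filter_erase, Finset.erase_eq_of_notMem]
      simp [h1]
    rw [hc] at hh
    simp only [Set.mem_iUnion, Set.mem_ofPred_eq, Finset.mem_Icc]
    refine ⟨_, ⟨critCount_le_of_le hh, ?_⟩, h1, rfl⟩
    rw [← hcard]
    exact Finset.card_filter_le _ _
  calc _ ≤ _ := measureReal_mono hsub (measure_ne_top _ _)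
    _ ≤ _ := measureReal_biUnion_finset_le _ _
    _ = _ := by
      rw [hopefulTail, Finset.mul_sum]
      refine Finset.sum_congr rfl fun k _ => ?_
      rw [initialLaw_real_other_and_colourCount_eq h c (Finset.notMem_erase x _), hcard]

theorem cond_real_hopeful_le (h : ρ ∈ Set.Ioo (0 : ℝ) 1) {w : ℕ} (hn : 2 * w + 1 ≤ n)
    (τ : Bool → ℝ) (c : Bool) (x : ZMod n) :
    (cond (initialLaw n ρ) {σ | σ x = !c}).real {σ | Hopeful w (τ true) (τ false) σ x} ≤
      hopefulTail (colourProb ρ c) (τ c) w := by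
  have h1 := initialLaw_real_hopeful_le h hn τ c x
  have h2 := initialLaw_real_node h c x
  have h3 := (colourProb_mem h c).2
  have h4 : 0 < 1 - colourProb ρ c := by linarith
  rw [Measure.real, cond_apply .of_discrete, ENNReal.toReal_mul, ENNReal.toReal_inv,
    inv_mul_le_iff₀]
  · change (initialLaw n ρ).real _ ≤ (initialLaw n ρ).real _ * _
    rw [h2]
    exact h1
  · change 0 < (initialLaw n ρ).real _
    rw [h2]
    exact h4

/-- Keeping only the largest intractable count loses nothing that matters at exponential scale. -/
theorem le_initialLaw_real_intractable (h : ρ ∈ Set.Ioo (0 : ℝ) 1) {w : ℕ} (hn : w + 1 ≤ n)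
    {τ : Bool → ℝ} {c : Bool} (hτ : 0 < τ c) (hw : w + 1 ≤ critCount (τ c) w) (a : ZMod n) :
    intractableTerm (colourProb ρ c) (τ c) w ≤
      (initialLaw n ρ).real {σ | Intractable w τ c σ a} := by
  have := isProbabilityMeasure_initialLaw n ρ h.1.le h.2.le
  have e := initialLaw_real_colourCount_eq h c (interval a w) (critCount (τ c) w - (w + 1))
  rw [card_interval a hn] at e
  rw [intractableTerm, ← e]
  refine measureReal_mono fun σ hσ => ?_
  rw [Set.mem_ofPred_eq] at hσ
  rw [Set.mem_ofPred_eq, Intractable, hσ, Nat.cast_sub hw]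
  have := critCount_lt hτ w
  push_cast
  linarith

theorem initialLaw_real_inter (h : ρ ∈ Set.Ioo (0 : ℝ) 1) {A B : Finset (ZMod n)}
    (hAB : Disjoint A B) {E F : Set (Config n)} (hE : DeterminedBy A E) (hF : DeterminedBy B F) :
    (initialLaw n ρ).real (E ∩ F) = (initialLaw n ρ).real E * (initialLaw n ρ).real F := by
  have := isProbabilityMeasure_nodeLaw h
  have hind : iIndepFun (fun (i : ZMod n) (σ : Config n) => σ i) (initialLaw n ρ) :=
    iIndepFun_pi (μ := fun _ : ZMod n => nodeLaw ρ) (X := fun _ c => c)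
      (fun _ => aemeasurable_id)
  have h2 := hind.indepFun_finset A B hAB (fun i => measurable_pi_apply i)
  -- An event determined by `A` is the preimage of its image under restriction to `A`, so
  -- independence of the restrictions applies.
  have pre : ∀ {A : Finset (ZMod n)} {E : Set (Config n)}, DeterminedBy A E →
      (fun (σ : Config n) (i : A) => σ i) ⁻¹' ((fun (σ : Config n) (i : A) => σ i) '' E) = E := by
    intro A E hE
    refine Set.Subset.antisymm ?_ (Set.subset_preimage_image _ _)
    rintro σ ⟨σ', hσ', he⟩
    exact hE σ' σ (fun y hy => congrFun he ⟨y, hy⟩) hσ'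
  have h3 := h2.measure_inter_preimage_eq_mul _ _
    (MeasurableSet.of_discrete (s := (fun (σ : Config n) (i : A) => σ i) '' E))
    (MeasurableSet.of_discrete (s := (fun (σ : Config n) (i : B) => σ i) '' F))
  rw [pre hE, pre hF] at h3
  rw [Measure.real, h3, ENNReal.toReal_mul]
  rfl

theorem initialLaw_real_forall_le_pow (h : ρ ∈ Set.Ioo (0 : ℝ) 1) {A : ℕ → Finset (ZMod n)}
    {E : ℕ → Set (Config n)} {q : ℝ} {m : ℕ}
    (hA : ∀ i j, i < j → j < m → Disjoint (A i) (A j))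
    (hE : ∀ i < m, DeterminedBy (A i) (E i)) (hq : ∀ i < m, (initialLaw n ρ).real (E i) ≤ q) :
    (initialLaw n ρ).real {σ | ∀ i < m, σ ∈ E i} ≤ q ^ m := by
  have := isProbabilityMeasure_initialLaw n ρ h.1.le h.2.le
  induction m with
  | zero => simp
  | succ m ih =>
    have e : {σ | ∀ i < m + 1, σ ∈ E i} = {σ | ∀ i < m, σ ∈ E i} ∩ E m := by
      ext σ
      simp only [Set.mem_ofPred_eq, Set.mem_inter_iff, Nat.forall_lt_succ_right]
    have hd : DeterminedBy ((Finset.range m).biUnion A) {σ | ∀ i < m, σ ∈ E i} := by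
      intro σ σ' hs hσ i hi
      refine hE i (by omega) σ σ' (fun y hy => hs y ?_) (hσ i hi)
      exact Finset.mem_biUnion.2 ⟨i, Finset.mem_range.2 hi, hy⟩
    have hdisj : Disjoint ((Finset.range m).biUnion A) (A m) := by
      rw [Finset.disjoint_biUnion_left]
      intro i hi
      exact hA i m (Finset.mem_range.1 hi) (by omega)
    rw [e, initialLaw_real_inter h hdisj hd (hE m (by omega)), pow_succ]
    have h1 := ih (fun i j hij hj => hA i j hij (by omega)) (fun i hi => hE i (by omega))
      (fun i hi => hq i (by omega))
    have h2 := hq m (by omega)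
    have h3 : 0 ≤ (initialLaw n ρ).real (E m) := measureReal_nonneg
    have h4 : 0 ≤ (initialLaw n ρ).real {σ | ∀ i < m, σ ∈ E i} := measureReal_nonneg
    exact mul_le_mul h1 h2 h3 (h4.trans h1)

/-- Union bound: over the at most `2m(w+1)+1` nodes of the window for hopefulness, and over the two
sides, where the `m` blocks are disjoint and hence independent. -/
theorem initialLaw_real_exposed_le (h : ρ ∈ Set.Ioo (0 : ℝ) 1) {w m : ℕ}
    (hn : 2 * w + 1 ≤ n) (hm : m * (w + 1) ≤ n) {τ : Bool → ℝ} {c : Bool} (hτ : 0 < τ c)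
    (hw : w + 1 ≤ critCount (τ c) w) (x : ZMod n) :
    (initialLaw n ρ).real {σ | Exposed w τ c m x σ} ≤
      (2 * (m * (w + 1)) + 1) * hopefulTail (colourProb ρ c) (τ c) w +
        2 * (1 - intractableTerm (colourProb ρ c) (τ c) w) ^ m := by
  have := isProbabilityMeasure_initialLaw n ρ h.1.le h.2.le
  obtain ⟨hp0, hp1⟩ := colourProb_mem h c
  set M := m * (w + 1) with hM
  have hnot : ∀ a : ZMod n, (initialLaw n ρ).real {σ | ¬ Intractable w τ c σ a} ≤
      1 - intractableTerm (colourProb ρ c) (τ c) w := by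
    intro a
    have h1 := le_initialLaw_real_intractable h (by omega) hτ hw a
    have h2 := probReal_compl_eq_one_sub (μ := initialLaw n ρ)
      (MeasurableSet.of_discrete (s := {σ : Config n | Intractable w τ c σ a}))
    rw [Set.compl_ofPred] at h2
    rw [h2]
    linarith
  have hR := initialLaw_real_forall_le_pow h (m := m)
    (A := fun k => interval (x + ((k * (w + 1) : ℕ) : ZMod n)) w)
    (E := fun k => {σ | ¬ Intractable w τ c σ (x + ((k * (w + 1) : ℕ) : ZMod n))})
    (fun i j hij hj => disjoint_right_intervals hm x hij hj)
    (fun i _ => determinedBy_not_intractable w τ c _) (fun i _ => hnot _)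
  have hL := initialLaw_real_forall_le_pow h (m := m)
    (A := fun k => interval (x - ((k * (w + 1) + w : ℕ) : ZMod n)) w)
    (E := fun k => {σ | ¬ Intractable w τ c σ (x - ((k * (w + 1) + w : ℕ) : ZMod n))})
    (fun i j hij hj => disjoint_left_intervals hm x hij hj)
    (fun i _ => determinedBy_not_intractable w τ c _) (fun i _ => hnot _)
  have hf0 : 0 ≤ hopefulTail (colourProb ρ c) (τ c) w :=
    Finset.sum_nonneg fun i _ => binomTerm_nonneg hp0.le hp1.le _ _
  have hH : (initialLaw n ρ).real {σ | ∃ y ∈ window x M M, σ y = !c ∧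
      Hopeful w (τ true) (τ false) σ y} ≤
      (2 * (m * (w + 1)) + 1) * hopefulTail (colourProb ρ c) (τ c) w := by
    have e : {σ : Config n | ∃ y ∈ window x M M, σ y = !c ∧ Hopeful w (τ true) (τ false) σ y} =
        ⋃ y ∈ window x M M, {σ | σ y = !c ∧ Hopeful w (τ true) (τ false) σ y} := by
      ext σ
      simp only [Set.mem_ofPred_eq, Set.mem_iUnion, exists_prop]
    rw [e]
    refine (measureReal_biUnion_finset_le _ _).trans ?_
    refine (Finset.sum_le_card_nsmul _ _ (hopefulTail (colourProb ρ c) (τ c) w)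
      fun y _ => (initialLaw_real_hopeful_le h hn τ c y).trans ?_).trans ?_
    · nlinarith
    · rw [nsmul_eq_mul]
      have : ((window x M M).card : ℝ) ≤ 2 * (m * (w + 1)) + 1 := by
        have h1 : ((window x M M).card : ℝ) ≤ (M + M + 1 : ℕ) := by
          exact_mod_cast card_window_le x M M
        rw [hM] at h1 ⊢
        push_cast at h1
        linarith
      gcongr
  have hsub : {σ : Config n | Exposed w τ c m x σ} =
      {σ | ∃ y ∈ window x M M, σ y = !c ∧ Hopeful w (τ true) (τ false) σ y} ∪
      ({σ | ∀ k < m, σ ∈ {σ | ¬ Intractable w τ c σ (x + ((k * (w + 1) : ℕ) : ZMod n))}} ∪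
       {σ | ∀ k < m, σ ∈ {σ | ¬ Intractable w τ c σ (x - ((k * (w + 1) + w : ℕ) : ZMod n))}}) := rfl
  rw [hsub]
  have u1 := measureReal_union_le (μ := initialLaw n ρ)
      {σ | ∃ y ∈ window x M M, σ y = !c ∧ Hopeful w (τ true) (τ false) σ y}
      ({σ | ∀ k < m, σ ∈ {σ | ¬ Intractable w τ c σ (x + ((k * (w + 1) : ℕ) : ZMod n))}} ∪
       {σ | ∀ k < m, σ ∈ {σ | ¬ Intractable w τ c σ (x - ((k * (w + 1) + w : ℕ) : ZMod n))}})
  have u2 := measureReal_union_le (μ := initialLaw n ρ)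
      {σ | ∀ k < m, σ ∈ {σ | ¬ Intractable w τ c σ (x + ((k * (w + 1) : ℕ) : ZMod n))}}
      {σ | ∀ k < m, σ ∈ {σ | ¬ Intractable w τ c σ (x - ((k * (w + 1) + w : ℕ) : ZMod n))}}
  linarith

end

/-! ### From the law of the dynamic to legal paths -/

section

variable {n : ℕ} [NeZero n] {ρ : ℝ}

theorem selectiveLaw_initial (w : ℕ) (τg τr : ℝ)
    (B : Set (Config n)) :
    selectiveLaw n w ρ τg τr {path | path 0 ∈ B} = initialLaw n ρ B := by
  have hm : Measure.map (Preorder.frestrictLe 0) (selectiveLaw n w ρ τg τr) =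
      (initialLaw n ρ).map
        (MeasurableEquiv.piUnique (fun _ : Finset.Iic 0 => Config n)).symm := by
    unfold selectiveLaw Kernel.trajMeasure
    rw [Measure.map_comp _ _ (by fun_prop), Kernel.traj_map_frestrictLe, Kernel.partialTraj_self,
      Measure.id_comp]
  have hev : Measurable (fun f : (i : Finset.Iic 0) → Config n =>
      f ⟨0, Finset.mem_Iic.2 le_rfl⟩) := measurable_pi_apply _
  have hB : MeasurableSet ((fun f : (i : Finset.Iic 0) → Config n =>
      f ⟨0, Finset.mem_Iic.2 le_rfl⟩) ⁻¹' B) := hev .of_discrete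
  have h1 := congrArg (fun μ => μ ((fun f : (i : Finset.Iic 0) → Config n =>
      f ⟨0, Finset.mem_Iic.2 le_rfl⟩) ⁻¹' B)) hm
  beta_reduce at h1
  rw [Measure.map_apply (by fun_prop) hB, Measure.map_apply (by fun_prop) hB] at h1
  exact h1

/-- A single step of the dynamic recolours one hopeful node or does nothing. -/
def LegalStep (w : ℕ) (τg τr : ℝ) (σ σ' : Config n) : Prop :=
  σ' = σ ∨ ∃ y, Hopeful w τg τr σ y ∧ σ' = recolour σ y

theorem legalStep_of_mem_support {w : ℕ} {τg τr : ℝ} {σ σ' : Config n}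
    (h : σ' ∈ (selectiveStep w τg τr σ).support) : LegalStep w τg τr σ σ' := by
  unfold selectiveStep at h
  split_ifs at h with hne
  · rw [PMF.mem_support_map_iff] at h
    obtain ⟨y, hy, rfl⟩ := h
    rw [PMF.mem_support_uniformOfFinset_iff] at hy
    exact Or.inr ⟨y, by simpa [hopefulNodes] using hy, rfl⟩
  · rw [PMF.mem_support_pure_iff] at h
    exact Or.inl h

theorem selectiveStep_toMeasure_illegal (w : ℕ) (τg τr : ℝ) (σ : Config n) :
    (selectiveStep w τg τr σ).toMeasure {σ' | ¬ LegalStep w τg τr σ σ'} = 0 := by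
  rw [PMF.toMeasure_apply_eq_zero_iff _ .of_discrete, Set.disjoint_left]
  intro σ' h1 h2
  exact h2 (legalStep_of_mem_support h1)

theorem ae_legalStep (h : ρ ∈ Set.Ioo (0 : ℝ) 1) (w : ℕ) (τg τr : ℝ) (t : ℕ) :
    ∀ᵐ path ∂selectiveLaw n w ρ τg τr, LegalStep w τg τr (path t) (path (t + 1)) := by
  have := isProbabilityMeasure_initialLaw n ρ h.1.le h.2.le
  have hmap := Kernel.map_frestrictLe_trajMeasure_compProd_eq_map_trajMeasure
    (X := fun _ => Config n) (μ₀ := initialLaw n ρ) (κ := selectiveKernel n w τg τr) (a := t)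
  have hP := isProbabilityMeasure_selectiveLaw n w ρ τg τr h.1.le h.2.le
  let pair : ((i : Finset.Iic t) → Config n) × Config n → Config n × Config n :=
    fun q => (q.1 ⟨t, Finset.mem_Iic.2 le_rfl⟩, q.2)
  have hpair : Measurable pair := by fun_prop
  have hS : MeasurableSet (pair ⁻¹' {q | ¬ LegalStep w τg τr q.1 q.2}) :=
    hpair .of_discrete
  rw [ae_iff]
  have h1 := congrArg (fun μ => μ (pair ⁻¹' {q | ¬ LegalStep w τg τr q.1 q.2})) hmap
  beta_reduce at h1
  rw [Measure.map_apply (by fun_prop) hS, Measure.compProd_apply hS] at h1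
  refine Eq.trans (Eq.trans ?_ h1.symm) ?_
  · rfl
  · refine lintegral_eq_zero_of_ae_eq_zero (Filter.Eventually.of_forall fun hist => ?_)
    exact selectiveStep_toMeasure_illegal w τg τr _

/-- On a legal path a change of `x` to colour `c` requires `x` to be initially exposed for `c`, and
each change is to one of the two colours. -/
theorem selectiveLaw_change_le (h : ρ ∈ Set.Ioo (0 : ℝ) 1) {w : ℕ} (hn : w + 1 ≤ n)
    (τ : Bool → ℝ) (m : Bool → ℕ) (x : ZMod n) :
    selectiveLaw n w ρ (τ true) (τ false) {path | ∃ t : ℕ, path (t + 1) x ≠ path t x} ≤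
      initialLaw n ρ {σ | Exposed w τ true (m true) x σ} +
        initialLaw n ρ {σ | Exposed w τ false (m false) x σ} := by
  rw [← selectiveLaw_initial w (τ true) (τ false), ← selectiveLaw_initial w (τ true) (τ false)]
  refine le_trans (measure_mono_ae ?_) (measure_union_le _ _)
  filter_upwards [ae_all_iff.2 (ae_legalStep h w (τ true) (τ false))] with path hpath hx
  by_contra hc
  have h1 : ¬ Exposed w τ true (m true) x (path 0) := fun he => hc (Or.inl he)
  have h2 : ¬ Exposed w τ false (m false) x (path 0) := fun he => hc (Or.inr he)
  obtain ⟨t, ht⟩ := hx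
  cases hcol : path t x with
  | true => exact ht ((not_change_of_not_exposed hn hpath h2 t hcol).trans hcol.symm)
  | false => exact ht ((not_change_of_not_exposed hn hpath h1 t hcol).trans hcol.symm)

theorem changeProb_le {w : ℕ} {τg τr : ℝ} {b : ENNReal}
    (hb : ∀ x : ZMod n, selectiveLaw n w ρ τg τr {path | ∃ t : ℕ, path (t + 1) x ≠ path t x} ≤ b) :
    changeProb n w ρ τg τr ≤ b := by
  unfold changeProb
  calc _ ≤ ∑ x : ZMod n, PMF.uniformOfFintype (ZMod n) x * b :=
        Finset.sum_le_sum fun x _ => mul_le_mul_right (hb x) _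
    _ = b := by
      rw [← Finset.sum_mul, ← tsum_fintype (L := .unconditional _), PMF.tsum_coe, one_mul]

end

/-! ### Assembly -/

theorem exists_exposed_lt {ρ : ℝ} (hρ : ρ ∈ Set.Ioo (0 : ℝ) 1) {τ : Bool → ℝ} {c : Bool}
    (hτ : τ c ∈ Set.Ioo (0 : ℝ) 1) (h : threshold (colourProb ρ c) < τ c) {ε : ℝ} (hε : 0 < ε) :
    ∃ w₁ : ℕ, ∀ w, w₁ ≤ w → ∃ m : ℕ, ∀ (n : ℕ) [NeZero n], 2 * w + 1 ≤ n → m * (w + 1) ≤ n →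
      ∀ x : ZMod n, initialLaw n ρ {σ | Exposed w τ c m x σ} < ENNReal.ofReal ε := by
  have hp := colourProb_mem hρ c
  obtain ⟨ζ, hζ, w₀, hw₀⟩ := exists_hopefulTail_lt hp hτ.2 h
  obtain ⟨w₁, hw₁⟩ := exists_block_number hζ (w₀ := w₀)
    (fun w hw => binomTerm_pos hp.1 hp.2 (by have := hw₀ w hw; omega))
    (fun w _ => binomTerm_le_one hp.1.le hp.2.le _ _) (fun w hw => (hw₀ w hw).2.2.le) hε
  refine ⟨max w₀ w₁, fun w hw => ?_⟩
  obtain ⟨m, hm⟩ := hw₁ w (le_of_max_le_right hw)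
  -- The number of blocks depends on `w` alone, so the ring only has to be large enough to hold
  -- them.
  refine ⟨m, fun n _ hn hmn x => ?_⟩
  have := isProbabilityMeasure_initialLaw n ρ hρ.1.le hρ.2.le
  have h1 := initialLaw_real_exposed_le hρ hn hmn hτ.1 (hw₀ w (le_of_max_le_left hw)).1 x
  exact (ENNReal.lt_ofReal_iff_toReal_lt (measure_ne_top _ _)).2 (h1.trans_lt hm)

theorem staticAlmostEverywhere_of_threshold_lt {ρ : ℝ} (hρ : ρ ∈ Set.Ioo (0 : ℝ) 1)
    {τ : Bool → ℝ} (hτ : ∀ c, τ c ∈ Set.Ioo (0 : ℝ) 1)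
    (h : ∀ c, threshold (colourProb ρ c) < τ c) :
    StaticAlmostEverywhere ρ (τ true) (τ false) := by
  intro ε hε
  choose w₁ hw₁ using fun c => exists_exposed_lt hρ (hτ c) (h c) (half_pos hε)
  refine ⟨max (w₁ true) (w₁ false), fun w hw => ?_⟩
  obtain ⟨m, hm⟩ := hw₁ true w (le_of_max_le_left hw)
  obtain ⟨m', hm'⟩ := hw₁ false w (le_of_max_le_right hw)
  refine ⟨2 * w + 1 + m * (w + 1) + m' * (w + 1), fun n _ hn => ?_⟩
  have hE (x : ZMod n) := ENNReal.add_lt_add (hm n (by omega) (by omega) x)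
    (hm' n (by omega) (by omega) x)
  rw [← ENNReal.ofReal_add (half_pos hε).le (half_pos hε).le, add_halves] at hE
  -- Taking the worst node keeps the inequality strict after averaging over the ring.
  obtain ⟨x₀, hx₀⟩ := Finite.exists_max fun x : ZMod n =>
    initialLaw n ρ {σ | Exposed w τ true m x σ} + initialLaw n ρ {σ | Exposed w τ false m' x σ}
  refine lt_of_le_of_lt (changeProb_le fun x => ?_) (hE x₀)
  exact (selectiveLaw_change_le hρ (by omega) τ (fun c => if c then m else m') x).trans (hx₀ x)

theorem exists_cond_hopeful_lt {ρ : ℝ} (hρ : ρ ∈ Set.Ioo (0 : ℝ) 1) {τ : Bool → ℝ} {c : Bool}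
    (hτ : τ c ∈ Set.Ioo (0 : ℝ) 1) (h : threshold (colourProb ρ c) < τ c) :
    ∃ ζ ∈ Set.Ioo (0 : ℝ) 1, ∃ w₀ : ℕ, ∀ w : ℕ, w₀ ≤ w →
      ∀ (n : ℕ) [NeZero n], 2 * w + 1 ≤ n → ∀ x a : ZMod n,
        (cond (initialLaw n ρ) {σ | σ x = !c}).real {σ | Hopeful w (τ true) (τ false) σ x} <
          ζ ^ w * (initialLaw n ρ).real {σ | Intractable w τ c σ a} := by
  obtain ⟨ζ, hζ, w₀, hw₀⟩ := exists_hopefulTail_lt (colourProb_mem hρ c) hτ.2 h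
  refine ⟨ζ, hζ, w₀, fun w hw n _ hn x a => ?_⟩
  obtain ⟨h1, -, h3⟩ := hw₀ w hw
  refine (cond_real_hopeful_le hρ hn τ c x).trans_lt (h3.trans_le ?_)
  exact mul_le_mul_of_nonneg_left (le_initialLaw_real_intractable hρ (by omega) hτ.1 h1 a)
    (pow_nonneg hζ.1.le _)

end Schelling

theorem mainTheorem7 (ρ τg τr : ℝ) (hρ : ρ ∈ Set.Ioo (0 : ℝ) 1) (hτg : τg ∈ Set.Ioo (0 : ℝ) 1)
    (hτr : τr ∈ Set.Ioo (0 : ℝ) 1) (hg : Schelling.muGreen ρ < τg)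
    (hr : Schelling.muRed ρ < τr) :
    Schelling.StaticAlmostEverywhere ρ τg τr ∧
    (∃ ζ ∈ Set.Ioo (0 : ℝ) 1, ∃ w₀ : ℕ, ∀ w : ℕ, w₀ ≤ w →
      ∀ (n : ℕ) [NeZero n], 2 * w + 1 ≤ n → ∀ x a : ZMod n,
        Schelling.hopefulRedProb n w ρ τg τr x <
          ζ ^ w * Schelling.greenIntractableProb n w ρ τg a) ∧
    (∃ ζ ∈ Set.Ioo (0 : ℝ) 1, ∃ w₀ : ℕ, ∀ w : ℕ, w₀ ≤ w →
      ∀ (n : ℕ) [NeZero n], 2 * w + 1 ≤ n → ∀ x a : ZMod n,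
        Schelling.hopefulGreenProb n w ρ τg τr x <
          ζ ^ w * Schelling.redIntractableProb n w ρ τr a) := by
  -- Indexing the thresholds by colour lets one argument serve both green and red.
  obtain ⟨τ, rfl, rfl⟩ : ∃ τ : Bool → ℝ, τ true = τg ∧ τ false = τr :=
    ⟨fun c => bif c then τg else τr, rfl, rfl⟩
  have hτ : ∀ c, τ c ∈ Set.Ioo (0 : ℝ) 1 := Bool.forall_bool.2 ⟨hτr, hτg⟩
  have hthr : ∀ c, Schelling.threshold (Schelling.colourProb ρ c) < τ c := by
    simpa [Schelling.colourProb] using! And.intro hr hg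
  have hstatic := Schelling.staticAlmostEverywhere_of_threshold_lt hρ hτ hthr
  have hgreen := Schelling.exists_cond_hopeful_lt hρ (hτ true) (hthr true)
  have hred := Schelling.exists_cond_hopeful_lt hρ (hτ false) (hthr false)
  exact ⟨hstatic, hgreen, hred⟩
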